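/- Throughout, "smooth" means $C^\infty$, and "$k$-dimensional submanifold" of $\mathbb R^{N}$ means embedded smooth submanifold (without boundary, not necessarily closed). Let $1\le m\le n$ and $p\ge 1$ be integers and let $\mathcal O\subset\mathbb R^{n+p}$ be open. Let $\mathbf s_1,\dots,\mathbf s_m$ be a partial frame in involution on $\mathcal O$, i.e. smooth vector fields on $\mathcal O$ that are linearly independent at every point of $\mathcal O$ and satisfy $[\mathbf s_i,\mathbf s_j]\in\operatorname{Span}_{C^\infty(\mathcal O)}\{\mathbf s_1,\dots,\mathbf s_m\}$ for all $i,j$. Let $\Lambda\subset\mathcal O$ be an $(n-m)$-dimensional submanifold of $\mathbb R^{n+p}$ such that, for every $z\in\Lambda$, the sum of $\operatorname{Span}_{\mathbb R}\{\mathbf s_1|_z,\dots,\mathbf s_m|_z\}$ and $T_z\Lambda$ is direct (hence $n$-dimensional). Let $\bar z\in\Lambda$. For an open neighborhood $U\subset\mathcal O$ of $\bar z$ and an $n$-dimensional submanifold $\Gamma\subset\mathcal O$ of $\mathbb R^{n+p}$, say that $(U,\Gamma)$ is a tangent extension of $\Lambda$ at $\bar z$ if 1. $\Lambda\cap U=\Lambda\cap\Gamma$;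 2. $\mathbf s_i|_z\in T_z\Gamma$ for all $i=1,\dots,m$ and all $z\in\Gamma$. Then: (a) (Existence) A tangent extension $(\mathcal O_{\bar z},\Gamma_{\bar z})$ of $\Lambda$ at $\bar z$ exists. (b) (Local uniqueness) If $(U,\Gamma)$ and $(U',\Gamma')$ are tangent extensions of $\Lambda$ at $\bar z$, then there is an open set $V\subset U\cap U'$ with $\Lambda\cap V=\Lambda\cap U\cap U'$ (so $V$ is a neighborhood of $\Lambda\cap U\cap U'$, in particular of $\bar z$), such that $\Gamma\cap V=\Gamma'\cap V$, and $(V,\,\Gamma\cap\Gamma'\cap V)$ is a tangent extension of $\Lambda$ at $\bar z$. If $m=n$, then moreover $(U\cap U',\,\Gamma\cap\Gamma')$ itself is a tangent extension of $\Lambda$ at $\bar z$. -/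

import Mathlib

open scoped ContDiff

/-- `S` is an embedded (smooth, boundaryless) submanifold of dimension `k` of `ℝ^N`: around each of
its points there is a smooth diffeomorphism `φ` between open subsets of `ℝ^N` which straightens `S`
to the coordinate `k`-plane on which all coordinates except the first `k` vanish.
(Used for `k ≤ N` only. `S` need not be closed, connected or non-empty.) -/
def IsEmbeddedSubmanifold {N : ℕ} (k : ℕ) (S : Set (EuclideanSpace ℝ (Fin N))) : Prop :=
  ∀ z ∈ S, ∃ φ : OpenPartialHomeomorph (EuclideanSpace ℝ (Fin N)) (EuclideanSpace ℝ (Fin N)),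
    z ∈ φ.source ∧
    ContDiffOn ℝ ∞ φ φ.source ∧
    ContDiffOn ℝ ∞ φ.symm φ.target ∧
    ∀ x ∈ φ.source, (x ∈ S ↔ ∀ i : Fin N, k ≤ (i : ℕ) → φ x i = 0)

/-- `v` is the velocity at time `0` of a smooth curve that runs in `S` and is at `z` at time `0`. -/
def IsVelocityAt {N : ℕ} (S : Set (EuclideanSpace ℝ (Fin N)))
    (z v : EuclideanSpace ℝ (Fin N)) : Prop :=
  ∃ (γ : ℝ → EuclideanSpace ℝ (Fin N)) (ε : ℝ), 0 < ε ∧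
    ContDiffOn ℝ ∞ γ (Set.Ioo (-ε) ε) ∧
    (∀ t ∈ Set.Ioo (-ε) ε, γ t ∈ S) ∧
    γ 0 = z ∧ HasDerivAt γ v 0

/-- The tangent space `T_z S`, as a linear subspace of `ℝ^N`. For an embedded submanifold `S` the
velocities of curves already form a linear subspace, so that taking the span adds nothing. -/
def tangentSpaceOf {N : ℕ} (S : Set (EuclideanSpace ℝ (Fin N)))
    (z : EuclideanSpace ℝ (Fin N)) : Submodule ℝ (EuclideanSpace ℝ (Fin N)) :=
  Submodule.span ℝ {v | IsVelocityAt S z v}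

/-- `s₁, …, s_m` are smooth vector fields on the set `O` (open, in the applications), independent
at every point of `O`. The values of the `s i` outside `O` play no role. -/
structure IsPartialFrame {N m : ℕ} (O : Set (EuclideanSpace ℝ (Fin N)))
    (s : Fin m → EuclideanSpace ℝ (Fin N) → EuclideanSpace ℝ (Fin N)) : Prop where
  smooth : ∀ i, ContDiffOn ℝ ∞ (s i) O
  independent : ∀ z ∈ O, LinearIndependent ℝ (fun i => s i z)

/-- Every bracket `[s_i, s_j]` lies in the `C^∞(O)`-span of `s₁, …, s_m`. -/
def IsInInvolution {N m : ℕ} (O : Set (EuclideanSpace ℝ (Fin N)))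
    (s : Fin m → EuclideanSpace ℝ (Fin N) → EuclideanSpace ℝ (Fin N)) : Prop :=
  ∀ i j : Fin m, ∃ c : Fin m → EuclideanSpace ℝ (Fin N) → ℝ,
    (∀ k, ContDiffOn ℝ ∞ (c k) O) ∧
    ∀ z ∈ O, VectorField.lieBracket ℝ (s i) (s j) z = ∑ k, c k z • s k z

/-- `Γ` is an `n`-dimensional embedded submanifold of `ℝ^N` which, with respect to the open
neighbourhood `U ⊆ O` of `zbar`, extends `Λ` and is tangent to all the `s i`. -/
structure IsTangentExtension {N m : ℕ} (n : ℕ) (O : Set (EuclideanSpace ℝ (Fin N)))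
    (s : Fin m → EuclideanSpace ℝ (Fin N) → EuclideanSpace ℝ (Fin N))
    (Λ : Set (EuclideanSpace ℝ (Fin N))) (zbar : EuclideanSpace ℝ (Fin N))
    (U Γ : Set (EuclideanSpace ℝ (Fin N))) : Prop where
  isOpen : IsOpen U
  mem : zbar ∈ U
  subset : U ⊆ O
  submanifold : IsEmbeddedSubmanifold n Γ
  subset_domain : Γ ⊆ O
  inter_eq : Λ ∩ U = Λ ∩ Γ
  tangent : ∀ z ∈ Γ, ∀ i, s i z ∈ tangentSpaceOf Γ z

/-!
The theorem is Frobenius' theorem together with the statement that integral directions propagate.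

*Coordinates.* An involutive distribution is spanned near a point by commuting vector fields
(`exists_commuting_frame`): normalise the frame so that a fixed linear projection `π` maps it to a
constant frame; brackets of the normalised fields lie in the distribution and in `ker π`, hence
vanish. Write these fields as `z ↦ X z e`, linear in `e`. The flow `Φ (x, y)`, the value at
time `1` of the solution of `u' = X(u) x`, `u(0) = y`, is smooth in `(x, y)` by the implicit
function theorem in the Banach space of curves: at `x = 0` the integrated equation has the identity
as partial derivative in the curve. Since the fields commute, `t ↦ t X(u(t)) e` solves the
linearised equation, so the derivative of `Φ` in `x` in the direction `e` is `X(Φ) e`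
(`exists_commuting_flow`). Flowing from the points of `Λ`, shifted in the direction of a complement,
gives coordinates `((x, a), b)` in which the distribution is the span of the `x`-directions and `Λ`
is `x = 0, b = 0` (`exists_adapted_chart`). The slice `b = 0` is a tangent extension
(`exists_isTangentExtension`).

*Uniqueness.* Let `Γ` be tangent to the distribution and contain `Λ`, with straightening equations
`G = 0` in the adapted coordinates. The derivative of `G` in the `x`-directions vanishes on `G = 0`,
so it is bounded by a multiple of `‖G‖`, and Grönwall's inequality propagates `G = 0` from `Λ` along
the `x`-directions (`eventually_snd_eq_zero`). Hence `Γ` contains the slice `b = 0`, and, having the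
same dimension, equals it near the base point (`eventually_snd_eq_zero_iff`). So two tangent
extensions agree near each common point of `Λ`, and the union of all open sets in which they agree
is the required `V`. If `m = n`, the same argument applies at every common point `z` of `Γ` and
`Γ'`, with `{z}` in the role of `Λ`.
-/

open Set Filter Topology

/-! ### Smooth local inverses and superposition operators -/

/-- The inverse function theorem for `C^∞` maps, with smoothness of both directions on the whole
domain of the local inverse. -/
theorem exists_smooth_localInverse {E F : Type*} [NormedAddCommGroup E] [NormedSpace ℝ E]
    [CompleteSpace E] [NormedAddCommGroup F] [NormedSpace ℝ F] {f : E → F} {U : Set E}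
    (hU : IsOpen U) (hf : ContDiffOn ℝ ∞ f U) {a : E} (ha : a ∈ U) {f' : E ≃L[ℝ] F}
    (hf' : HasFDerivAt f (f' : E →L[ℝ] F) a) :
    ∃ φ : OpenPartialHomeomorph E F, a ∈ φ.source ∧ φ.source ⊆ U ∧ (∀ x, φ x = f x) ∧
      ContDiffOn ℝ ∞ φ.symm φ.target := by
  have hat : ∀ x ∈ U, ContDiffAt ℝ ∞ f x := fun x hx => hf.contDiffAt (hU.mem_nhds hx)
  have hne : (∞ : WithTop ℕ∞) ≠ 0 := by simp
  set φ₀ := (hat a ha).toOpenPartialHomeomorph f hf' hne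
  -- where the derivative is invertible, the inverse of the local homeomorphism is smooth
  set W : Set E := U ∩ fderiv ℝ f ⁻¹' range ContinuousLinearEquiv.toContinuousLinearMap
  have hW : IsOpen W :=
    (hf.continuousOn_fderiv_of_isOpen hU (by simp)).isOpen_inter_preimage hU
      ContinuousLinearEquiv.isOpen
  have haW : a ∈ W := ⟨ha, f', hf'.fderiv.symm⟩
  refine ⟨φ₀.restrOpen W hW, ⟨(hat a ha).mem_toOpenPartialHomeomorph_source hf' hne, haW⟩,
    fun x hx => hx.2.1, fun x => rfl, ?_⟩
  intro y hy
  have hys := (φ₀.restrOpen W hW).map_target hy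
  obtain ⟨hyU, e, he⟩ := hys.2
  refine ((φ₀.restrOpen W hW).contDiffAt_symm (f₀' := e) hy ?_ (hat _ hyU)).contDiffWithinAt
  have : HasFDerivAt f (fderiv ℝ f ((φ₀.restrOpen W hW).symm y)) ((φ₀.restrOpen W hW).symm y) :=
    ((hat _ hyU).differentiableAt hne).hasFDerivAt
  rwa [← he] at this

section Superposition

variable {K E F : Type} [TopologicalSpace K] [CompactSpace K] [NormedAddCommGroup E]
  [NormedSpace ℝ E] [NormedAddCommGroup F] [NormedSpace ℝ F]

/-- Pointwise application of a continuous family of continuous linear maps to a continuous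
function, as a continuous bilinear map. -/
noncomputable def pointwiseApply (K E F : Type) [TopologicalSpace K] [CompactSpace K]
    [NormedAddCommGroup E] [NormedSpace ℝ E] [NormedAddCommGroup F] [NormedSpace ℝ F] :
    C(K, E →L[ℝ] F) →L[ℝ] C(K, E) →L[ℝ] C(K, F) :=
  LinearMap.mkContinuous₂
    (LinearMap.mk₂ ℝ (fun (A : C(K, E →L[ℝ] F)) (u : C(K, E)) =>
        (⟨fun k => A k (u k), by fun_prop⟩ : C(K, F)))
      (fun _ _ _ => by ext; simp) (fun _ _ _ => by ext; simp)
      (fun _ _ _ => by ext; simp) (fun _ _ _ => by ext; simp)) 1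
    (fun A u => by
      rw [one_mul]
      refine (ContinuousMap.norm_le _ (by positivity)).2 fun k => ?_
      exact (A k).le_of_opNorm_le_of_le (A.norm_coe_le_norm k) (u.norm_coe_le_norm k))

@[simp] theorem pointwiseApply_apply (A : C(K, E →L[ℝ] F)) (u : C(K, E)) (k : K) :
    pointwiseApply K E F A u k = A k (u k) := rfl

/-- The superposition operator `u ↦ f ∘ u` is differentiable, its derivative at `u` being
pointwise application of the derivative of `f` along `u`. -/
theorem hasFDerivAt_superposition (f : C(E, F)) (f' : C(E, E →L[ℝ] F))
    (hf : ∀ x, HasFDerivAt f (f' x) x) (u : C(K, E)) :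
    HasFDerivAt (fun v : C(K, E) => f.comp v) (pointwiseApply K E F (f'.comp u)) u := by
  rw [hasFDerivAt_iff_isLittleO, Asymptotics.isLittleO_iff]
  intro c hc
  -- `f'` is uniformly continuous near the compact range of `u`
  have hunif := (isCompact_range u.continuous).uniformContinuousAt_of_continuousAt f'
    (fun a _ => f'.continuous.continuousAt) (Metric.dist_mem_uniformity hc)
  obtain ⟨δ, hδ, hδu⟩ := Metric.mem_uniformity_dist.1 hunif
  filter_upwards [Metric.ball_mem_nhds u hδ] with v hv
  refine (ContinuousMap.norm_le _ (by positivity)).2 fun k => ?_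
  have hk : dist (u k) (v k) < δ := by
    rw [dist_comm]; exact (ContinuousMap.dist_apply_le_dist k).trans_lt hv
  have := Convex.norm_image_sub_le_of_norm_hasFDerivWithin_le' (f := f) (f' := f') (C := c)
    (φ := f' (u k)) (s := Metric.ball (u k) δ) (x := u k) (y := v k)
    (fun x _ => (hf x).hasFDerivWithinAt)
    (fun x hx => by
      have := hδu (a := u k) (b := x) (by rw [dist_comm]; exact hx) (mem_range_self k)
      rw [← dist_eq_norm, dist_comm]; exact this.le)
    (convex_ball _ _) (Metric.mem_ball_self hδ) (by rw [Metric.mem_ball, dist_comm]; exact hk)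
  refine LE.le.trans this ?_
  gcongr
  exact (v - u).norm_coe_le_norm k

/-- The superposition operator `u ↦ f ∘ u` on continuous functions is `C^∞` if `f` is. -/
theorem contDiff_superposition (f : C(E, F)) (hf : ContDiff ℝ ∞ f) :
    ContDiff ℝ ∞ (fun v : C(K, E) => f.comp v) := by
  rw [contDiff_infty]
  intro n
  induction n generalizing F with
  | zero => exact contDiff_zero.2 (ContinuousMap.continuous_postcomp f)
  | succ n ih =>
    have h1 : ContDiff ℝ ∞ (fderiv ℝ f) := hf.fderiv_right (by simp)
    push_cast
    rw [contDiff_succ_iff_hasFDerivAt]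
    refine ⟨fun u => pointwiseApply K E F ((⟨fderiv ℝ f, h1.continuous⟩ : C(_, _)).comp u),
      ?_, fun u => ?_⟩
    · have h2 := ih (⟨fderiv ℝ f, h1.continuous⟩ : C(E, E →L[ℝ] F)) h1
      exact (pointwiseApply K E F).contDiff.comp h2
    · exact hasFDerivAt_superposition f ⟨fderiv ℝ f, h1.continuous⟩
        (fun x => (hf.differentiable (by simp) x).hasFDerivAt) u

theorem contDiff_pointwiseApply_superposition {V : Type} [NormedAddCommGroup V] [NormedSpace ℝ V]
    (X : C(E, V →L[ℝ] F)) (hX : ContDiff ℝ ∞ X) :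
    ContDiff ℝ ∞ (fun v : C(K, E) => pointwiseApply K V F (X.comp v)) := by
  have h := contDiff_superposition (K := K) X hX
  exact (pointwiseApply K V F).contDiff.comp h

theorem hasFDerivAt_pointwiseApply_superposition {V : Type} [NormedAddCommGroup V]
    [NormedSpace ℝ V] (X : C(E, V →L[ℝ] F)) (X' : C(E, E →L[ℝ] V →L[ℝ] F))
    (hX : ∀ x, HasFDerivAt X (X' x) x) (u : C(K, E)) :
    HasFDerivAt (fun v : C(K, E) => pointwiseApply K V F (X.comp v))
      (pointwiseApply K V F ∘L pointwiseApply K E (V →L[ℝ] F) (X'.comp u)) u := by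
  have h := hasFDerivAt_superposition X X' hX u
  exact (pointwiseApply K V F).hasFDerivAt.comp u h

end Superposition

/-! ### Parameter dependence of flows: the integrated equation on curves -/

section Exponential

/-- The Volterra operator `u ↦ (t ↦ ∫₀ᵗ u)` on continuous curves over `[0, 1]`. -/
noncomputable def volterra (E : Type) [NormedAddCommGroup E] [NormedSpace ℝ E] [CompleteSpace E] :
    C(Icc (0:ℝ) 1, E) →L[ℝ] C(Icc (0:ℝ) 1, E) :=
  LinearMap.mkContinuous
    { toFun := fun u => ⟨fun t => ∫ s in (0:ℝ)..t, u (projIcc 0 1 zero_le_one s), by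
        have hc : Continuous fun s : ℝ => u (projIcc 0 1 zero_le_one s) :=
          u.continuous.comp continuous_projIcc
        exact (intervalIntegral.continuous_primitive (fun a b => hc.intervalIntegrable a b) 0).comp
          continuous_subtype_val⟩
      map_add' := fun u v => by
        ext t
        exact intervalIntegral.integral_add
          ((u.continuous.comp continuous_projIcc).intervalIntegrable _ _)
          ((v.continuous.comp continuous_projIcc).intervalIntegrable _ _)
      map_smul' := fun c u => by
        ext t
        exact intervalIntegral.integral_smul c _ } 1
    (fun u => by
      rw [one_mul]
      refine (ContinuousMap.norm_le _ (by positivity)).2 fun t => ?_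
      have := intervalIntegral.norm_integral_le_of_norm_le_const (a := (0:ℝ)) (b := t)
        (f := fun s : ℝ => u (projIcc 0 1 zero_le_one s)) (C := ‖u‖)
        (fun s _ => u.norm_coe_le_norm _)
      refine LE.le.trans this (mul_le_of_le_one_right (norm_nonneg _) ?_)
      rw [sub_zero, abs_of_nonneg t.2.1]
      exact t.2.2)

theorem volterra_apply {E : Type} [NormedAddCommGroup E] [NormedSpace ℝ E] [CompleteSpace E]
    (u : C(Icc (0:ℝ) 1, E)) (t : Icc (0:ℝ) 1) :
    volterra E u t = ∫ s in (0:ℝ)..t, u (projIcc 0 1 zero_le_one s) := rfl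

variable {V E : Type} [NormedAddCommGroup V] [NormedSpace ℝ V] [NormedAddCommGroup E]
  [NormedSpace ℝ E] [CompleteSpace E]

/-- Constant curves over `[0, 1]`. -/
noncomputable abbrev constCurve (E : Type) [NormedAddCommGroup E] [NormedSpace ℝ E] :
    E →L[ℝ] C(Icc (0:ℝ) 1, E) :=
  ContinuousLinearMap.const ℝ (Icc (0:ℝ) 1)

/-- The defect of a curve `u` as a solution of `u' = X(u) x`, `u(0) = y`, in integrated form:
`odeDefect X ((x, y), u) = u - y - ∫ X(u) x`. -/
noncomputable def odeDefect (X : C(E, V →L[ℝ] E)) (q : (V × E) × C(Icc (0:ℝ) 1, E)) :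
    C(Icc (0:ℝ) 1, E) :=
  q.2 - constCurve E q.1.2 -
    volterra E (pointwiseApply _ V E (X.comp q.2) (constCurve V q.1.1))

theorem contDiff_odeDefect (X : C(E, V →L[ℝ] E)) (hX : ContDiff ℝ ∞ X) :
    ContDiff ℝ ∞ (odeDefect X) := by
  have h2 : ContDiff ℝ ∞ fun q : (V × E) × C(Icc (0:ℝ) 1, E) =>
      pointwiseApply (Icc (0:ℝ) 1) V E (X.comp q.2) :=
    (contDiff_pointwiseApply_superposition X hX).comp contDiff_snd
  have h3 : ContDiff ℝ ∞ fun q : (V × E) × C(Icc (0:ℝ) 1, E) => constCurve V q.1.1 :=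
    (constCurve V).contDiff.comp (contDiff_fst.comp contDiff_fst)
  have h4 : ContDiff ℝ ∞ fun q : (V × E) × C(Icc (0:ℝ) 1, E) => constCurve E q.1.2 :=
    (constCurve E).contDiff.comp (contDiff_snd.comp contDiff_fst)
  exact (contDiff_snd.sub h4).sub ((volterra E).contDiff.comp (h2.clm_apply h3))

/-- The derivative of the defect is the integrated linearised equation. -/
theorem fderiv_odeDefect_apply (X : C(E, V →L[ℝ] E))
    (X' : C(E, E →L[ℝ] V →L[ℝ] E)) (hX' : ∀ z, HasFDerivAt X (X' z) z)
    (q : (V × E) × C(Icc (0:ℝ) 1, E)) (e : V) (b : E) (J : C(Icc (0:ℝ) 1, E)) :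
    fderiv ℝ (odeDefect X) q ((e, b), J) = J - constCurve E b - volterra E
      (pointwiseApply _ V E (X.comp q.2) (constCurve V e) +
        pointwiseApply _ V E (pointwiseApply _ E (V →L[ℝ] E) (X'.comp q.2) J)
          (constCurve V q.1.1)) := by
  have h1 := hasFDerivAt_pointwiseApply_superposition X X' hX' q.2
  have h2 := HasFDerivAt.comp (G := C(Icc (0:ℝ) 1, V) →L[ℝ] C(Icc (0:ℝ) 1, E)) q h1
    (hasFDerivAt_snd (𝕜 := ℝ) (p := q))
  have h3 := (constCurve V).hasFDerivAt.comp q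
    ((hasFDerivAt_fst (𝕜 := ℝ) (p := q.1)).comp q (hasFDerivAt_fst (𝕜 := ℝ) (p := q)))
  have h4 := (constCurve E).hasFDerivAt.comp q
    ((hasFDerivAt_snd (𝕜 := ℝ) (p := q.1)).comp q (hasFDerivAt_fst (𝕜 := ℝ) (p := q)))
  have h5 := ((hasFDerivAt_snd (𝕜 := ℝ) (p := q)).sub h4).sub
    ((volterra E).hasFDerivAt.comp q (h2.clm_apply h3))
  have h6 : HasFDerivAt (odeDefect X) _ q := h5
  rw [h6.fderiv]
  rfl

/-- If the vector fields `z ↦ X z x` commute along a solution `u` of `u' = X(u) x`, then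
`t ↦ t X(u(t)) e` solves the linearised equation for the variation of `x` in the direction `e`. -/
theorem fderiv_odeDefect_eq_zero (X : C(E, V →L[ℝ] E)) (hX : ContDiff ℝ ∞ X)
    {x : V} {y : E} {u : C(Icc (0:ℝ) 1, E)} (hu : odeDefect X ((x, y), u) = 0)
    (hcomm : ∀ t, ∀ e f : V, fderiv ℝ X (u t) (X (u t) e) f = fderiv ℝ X (u t) (X (u t) f) e)
    (e : V) :
    fderiv ℝ (odeDefect X) ((x, y), u)
      ((e, 0), ⟨fun t => (t : ℝ) • X (u t) e, by fun_prop⟩) = 0 := by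
  have hX1 : ContDiff ℝ ∞ (fderiv ℝ X) := hX.fderiv_right (by simp)
  rw [fderiv_odeDefect_apply X ⟨fderiv ℝ X, hX1.continuous⟩
    (fun z => (hX.differentiable (by simp) z).hasFDerivAt)]
  set g : ℝ → E := fun s => X (u (projIcc 0 1 zero_le_one s)) x with hg
  have hgc : Continuous g :=
    ((X.continuous.comp (u.continuous.comp continuous_projIcc)).clm_apply continuous_const)
  -- the extension of `u` to a differentiable curve on the line
  set w : ℝ → E := fun t => y + ∫ s in (0:ℝ)..t, g s with hw
  have hwd : ∀ t, HasDerivAt w (g t) t := fun t =>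
    (intervalIntegral.integral_hasDerivAt_right (hgc.intervalIntegrable _ _)
      (hgc.stronglyMeasurableAtFilter _ _) hgc.continuousAt).const_add y
  have hwc : Continuous w := continuous_iff_continuousAt.2 fun t => (hwd t).continuousAt
  have huw : ∀ t : Icc (0:ℝ) 1, w t = u t := by
    intro t
    have := DFunLike.congr_fun hu t
    simp only [odeDefect, ContinuousMap.sub_apply, ContinuousLinearMap.const_apply_apply,
      volterra_apply, pointwiseApply_apply, ContinuousMap.comp_apply, ContinuousMap.zero_apply] at this
    rw [hw]
    have h0 : u t = y + ∫ s in (0:ℝ)..t, X (u (projIcc 0 1 zero_le_one s)) x := by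
      rw [sub_sub, sub_eq_zero] at this
      exact this
    exact h0.symm
  set k' : ℝ → E := fun t => t • (fderiv ℝ X (w t) (g t)) e + X (w t) e with hk'
  have hkd : ∀ t, HasDerivAt (fun t => t • X (w t) e) (k' t) t := by
    intro t
    have h1 : HasDerivAt (fun t => X (w t)) (fderiv ℝ X (w t) (g t)) t :=
      (hX.differentiable (by simp) (w t)).hasFDerivAt.comp_hasDerivAt t (hwd t)
    have h2 : HasDerivAt (fun t => X (w t) e) ((fderiv ℝ X (w t) (g t)) e) t := by
      simpa using h1.clm_apply (hasDerivAt_const t e)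
    simpa [hk'] using (hasDerivAt_id' t).fun_smul h2
  have hkc : Continuous k' := by
    refine (continuous_id.smul ?_).add ((X.continuous.comp hwc).clm_apply continuous_const)
    exact ((hX1.continuous.comp hwc).clm_apply hgc).clm_apply continuous_const
  ext t
  have hint := intervalIntegral.integral_eq_sub_of_hasDerivAt (a := (0:ℝ)) (b := t)
    (fun s _ => hkd s) (hkc.intervalIntegrable _ _)
  simp only [ContinuousMap.sub_apply, ContinuousLinearMap.const_apply_apply,
    volterra_apply, ContinuousMap.add_apply,
    pointwiseApply_apply, ContinuousMap.comp_apply, ContinuousMap.zero_apply,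
    ContinuousMap.coe_mk, sub_zero, zero_smul] at hint ⊢
  rw [huw] at hint
  rw [← hint, sub_eq_zero]
  refine intervalIntegral.integral_congr fun s hs => ?_
  rw [uIcc_of_le t.2.1] at hs
  have hsI : s ∈ Icc (0:ℝ) 1 := ⟨hs.1, hs.2.trans t.2.2⟩
  have hws : w s = u ⟨s, hsI⟩ := huw ⟨s, hsI⟩
  simp only [hk', hg, hws, projIcc_of_mem zero_le_one hsI, map_smul,
    smul_apply, hcomm ⟨s, hsI⟩ x e]
  rw [add_comm]

end Exponential

/-! ### The common flow of commuting vector fields -/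

/-- The implicit function theorem for `C^∞` maps whose partial derivative in the unknown is the
identity at the base point. The last clause says that the derivative of the implicit function is
determined by the linearised equation. -/
theorem exists_smooth_implicit {P C : Type*} [NormedAddCommGroup P] [NormedSpace ℝ P]
    [CompleteSpace P] [NormedAddCommGroup C] [NormedSpace ℝ C] [CompleteSpace C]
    {F : P × C → C} (hFs : ContDiff ℝ ∞ F) {p₀ : P} {u₀ : C} (hF0 : F (p₀, u₀) = 0)
    (hid : ∀ J, fderiv ℝ F (p₀, u₀) (0, J) = J) {W : Set C} (hW : IsOpen W) (hu₀ : u₀ ∈ W) :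
    ∃ (D : Set P) (u : P → C), IsOpen D ∧ p₀ ∈ D ∧ ContDiffOn ℝ ∞ u D ∧
      (∀ p ∈ D, F (p, u p) = 0) ∧ (∀ p ∈ D, u p ∈ W) ∧
      ∀ p ∈ D, ∀ w J, fderiv ℝ F (p, u p) (w, J) = 0 → fderiv ℝ u p w = J := by
  have hFd : ∀ q, HasFDerivAt F (fderiv ℝ F q) q := fun q =>
    (hFs.differentiable (by simp) q).hasFDerivAt
  set q₀ : P × C := (p₀, u₀) with hq₀
  set U : Set (P × C) :=
    {q | ‖fderiv ℝ F q ∘L ContinuousLinearMap.inr ℝ P C - ContinuousLinearMap.id ℝ C‖ < 1} ∩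
      {q | q.2 ∈ W} with hU
  have hUo : IsOpen U := by
    have hc : Continuous (fderiv ℝ F) := hFs.continuous_fderiv (by simp)
    refine (isOpen_lt ?_ continuous_const).inter (hW.preimage continuous_snd)
    exact ((hc.clm_comp continuous_const).sub continuous_const).norm
  have hq₀U : q₀ ∈ U := by
    refine ⟨?_, hu₀⟩
    have : fderiv ℝ F q₀ ∘L ContinuousLinearMap.inr ℝ P C = ContinuousLinearMap.id ℝ C :=
      ContinuousLinearMap.ext hid
    simp [this]
  -- injectivity of the partial derivative in the unknown
  have hinj : ∀ q ∈ U, ∀ J, fderiv ℝ F q (0, J) = 0 → J = 0 := by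
    intro q hq J hJ
    by_contra hne
    have h1 := (fderiv ℝ F q ∘L ContinuousLinearMap.inr ℝ P C -
      ContinuousLinearMap.id ℝ C).le_opNorm J
    have h2 : (fderiv ℝ F q ∘L ContinuousLinearMap.inr ℝ P C -
      ContinuousLinearMap.id ℝ C) J = -J := by simp [hJ]
    rw [h2, norm_neg] at h1
    have h3 := hq.1
    simp only [mem_ofPred_eq] at h3
    nlinarith [norm_pos_iff.2 hne]
  set H : P × C → P × C := fun q => (q.1, F q) with hH
  have hHs : ContDiff ℝ ∞ H := contDiff_fst.prodMk hFs
  have hHd : HasFDerivAt H ((ContinuousLinearMap.fst ℝ P C).prod (fderiv ℝ F q₀)) q₀ :=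
    hasFDerivAt_fst.prodMk (hFd q₀)
  have hsplit : ∀ p J, fderiv ℝ F q₀ (p, J) = fderiv ℝ F q₀ (p, 0) + J := by
    intro p J
    conv_lhs => rw [show (p, J) = (p, 0) + (0, J) by simp, map_add, hid]
  let e : (P × C) ≃L[ℝ] (P × C) :=
    ContinuousLinearEquiv.equivOfInverse
      ((ContinuousLinearMap.fst ℝ P C).prod (fderiv ℝ F q₀))
      ((ContinuousLinearMap.fst ℝ P C).prod (ContinuousLinearMap.snd ℝ P C -
        fderiv ℝ F q₀ ∘L ContinuousLinearMap.inl ℝ P C ∘L ContinuousLinearMap.fst ℝ P C))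
      (fun q => by
        refine Prod.ext rfl ?_
        have := hsplit q.1 q.2
        simp only [Prod.mk.eta] at this
        simp [this])
      (fun q => by
        refine Prod.ext rfl ?_
        have := hsplit q.1 (q.2 - fderiv ℝ F q₀ (q.1, 0))
        simpa using this)
  obtain ⟨φ, hφ0, hφU, hφ, hφs⟩ := exists_smooth_localInverse (f := H) hUo hHs.contDiffOn hq₀U
    (f' := e) hHd
  set u : P → C := fun p => (φ.symm (p, 0)).2 with hu
  set D₀ : Set P := {p | (p, (0 : C)) ∈ φ.target} with hD₀
  have hD₀o : IsOpen D₀ := φ.open_target.preimage (by fun_prop)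
  have husm : ContDiffOn ℝ ∞ u D₀ :=
    contDiff_snd.comp_contDiffOn
      (hφs.comp (f := fun p : P => (p, (0 : C)))
        (contDiff_id.prodMk contDiff_const).contDiffOn (fun p hp => hp))
  have hpu : ∀ p ∈ D₀, φ.symm (p, 0) = (p, u p) := by
    intro p hp
    have := φ.right_inv hp
    rw [hφ] at this
    have h1 : (φ.symm (p, 0)).1 = p := congrArg Prod.fst this
    exact Prod.ext h1 rfl
  have huU : ∀ p ∈ D₀, (p, u p) ∈ U := by
    intro p hp
    rw [← hpu p hp]
    exact hφU (φ.map_target hp)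
  have huF : ∀ p ∈ D₀, F (p, u p) = 0 := by
    intro p hp
    have := φ.right_inv hp
    rw [hφ, hpu p hp] at this
    exact congrArg Prod.snd this
  refine ⟨D₀, u, hD₀o, ?_, husm, huF, fun p hp => (huU p hp).2, ?_⟩
  · have h := φ.map_source hφ0
    rw [hφ] at h
    have : H q₀ = (p₀, 0) := Prod.ext rfl hF0
    rwa [this] at h
  · intro q hq w J hJ
    have hud : HasFDerivAt u (fderiv ℝ u q) q :=
      ((husm.contDiffAt (hD₀o.mem_nhds hq)).differentiableAt (by simp)).hasFDerivAt
    have hcomp : HasFDerivAt (fun p => F (p, u p))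
        (fderiv ℝ F (q, u q) ∘L (ContinuousLinearMap.id ℝ _).prod (fderiv ℝ u q)) q :=
      HasFDerivAt.comp (f := fun p => (p, u p)) q (hFd (q, u q)) ((hasFDerivAt_id q).prodMk hud)
    have hzero : HasFDerivAt (fun p => F (p, u p)) (0 : P →L[ℝ] C) q := by
      refine (hasFDerivAt_const (0 : C) q).congr_of_eventuallyEq ?_
      filter_upwards [hD₀o.mem_nhds hq] with p hp using huF p hp
    have h1 : fderiv ℝ F (q, u q) (w, fderiv ℝ u q w) = 0 := by
      simpa using DFunLike.congr_fun (hcomp.unique hzero) w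
    refine sub_eq_zero.1 (hinj _ (huU q hq) _ ?_)
    have := (fderiv ℝ F (q, u q)).map_sub (w, fderiv ℝ u q w) (w, J)
    rw [h1, hJ] at this
    simpa using this

/-- Commuting vector fields `z ↦ X z e` have a smooth common flow `Φ (x, y)`: it starts at `y`, and
its derivative in the direction `e` of the parameter `x` is the field `X · e`. -/
theorem exists_commuting_flow {V E : Type} [NormedAddCommGroup V] [NormedSpace ℝ V]
    [CompleteSpace V] [NormedAddCommGroup E] [NormedSpace ℝ E] [CompleteSpace E]
    (X : C(E, V →L[ℝ] E)) (hX : ContDiff ℝ ∞ X) {z₀ : E}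
    (hcomm : ∀ᶠ z in 𝓝 z₀, ∀ e f : V, fderiv ℝ X z (X z e) f = fderiv ℝ X z (X z f) e) :
    ∃ (D : Set (V × E)) (Φ : V × E → E), IsOpen D ∧ (0, z₀) ∈ D ∧ ContDiffOn ℝ ∞ Φ D ∧
      (∀ y, (0, y) ∈ D → Φ (0, y) = y) ∧
      ∀ q ∈ D, ∀ e, fderiv ℝ Φ q (e, 0) = X (Φ q) e := by
  obtain ⟨r, hr, hball⟩ := Metric.eventually_nhds_iff_ball.1 hcomm
  have hX1 : ContDiff ℝ ∞ (fderiv ℝ X) := hX.fderiv_right (by simp)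
  obtain ⟨D, u, hDo, hD, husm, huF, huW, hud⟩ := exists_smooth_implicit
    (contDiff_odeDefect X hX) (p₀ := (0, z₀))
    (u₀ := constCurve E z₀)
    (by simp [odeDefect])
    (fun J => by
      have := fderiv_odeDefect_apply X ⟨fderiv ℝ X, hX1.continuous⟩
        (fun z => (hX.differentiable (by simp) z).hasFDerivAt)
        ((0, z₀), constCurve E z₀) 0 0 J
      simp only [map_zero, sub_zero, add_zero] at this
      exact this)
    (Metric.isOpen_ball (x := constCurve E z₀) (ε := r))
    (Metric.mem_ball_self hr)
  let L : C(Icc (0:ℝ) 1, E) →L[ℝ] E := ContinuousMap.evalCLM ℝ ⟨1, by simp⟩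
  refine ⟨D, fun p => L (u p), hDo, hD, L.contDiff.comp_contDiffOn husm, ?_, ?_⟩
  · intro y hy
    have h1 := huF _ hy
    have h2 : u (0, y) = constCurve E y := by
      simpa [odeDefect, sub_eq_zero] using h1
    exact DFunLike.congr_fun h2 (⟨1, by simp⟩ : Icc (0:ℝ) 1)
  · intro q hq e
    have h2 := fderiv_odeDefect_eq_zero X hX (huF q hq) (fun t => hball _
      ((ContinuousMap.dist_apply_le_dist (f := u q)
        (g := constCurve E z₀) t).trans_lt (huW q hq))) e
    have h5 := DFunLike.congr_fun (hud q hq _ _ h2) (⟨1, by simp⟩ : Icc (0:ℝ) 1)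
    have hev : HasFDerivAt (fun p => L (u p)) (L ∘L fderiv ℝ u q) q :=
      L.hasFDerivAt.comp q
        ((husm.contDiffAt (hDo.mem_nhds hq)).differentiableAt (by simp)).hasFDerivAt
    rw [hev.fderiv]
    simpa [L] using h5

/-! ### Commuting frames and Frobenius' theorem -/

/-- A smooth map on an open set agrees near a given point with a smooth map on the whole space. -/
theorem exists_contDiff_eventuallyEq {E F : Type*} [NormedAddCommGroup E] [NormedSpace ℝ E]
    [FiniteDimensional ℝ E] [NormedAddCommGroup F] [NormedSpace ℝ F] {f : E → F} {U : Set E}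
    (hU : IsOpen U) (hf : ContDiffOn ℝ ∞ f U) {z : E} (hz : z ∈ U) :
    ∃ g : E → F, ContDiff ℝ ∞ g ∧ g =ᶠ[𝓝 z] f := by
  obtain ⟨r, hr, hrU⟩ := Metric.nhds_basis_closedBall.mem_iff.1 (hU.mem_nhds hz)
  let χ : ContDiffBump z := ⟨r / 2, r, by positivity, by linarith⟩
  refine ⟨fun x => χ x • f x, contDiff_iff_contDiffAt.2 fun x => ?_, ?_⟩
  · by_cases hx : x ∈ U
    · exact χ.contDiff.contDiffAt.smul (hf.contDiffAt (hU.mem_nhds hx))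
    · have hx' : x ∉ tsupport χ := by
        rw [χ.tsupport_eq]
        exact fun h => hx (hrU h)
      refine (contDiffAt_const (c := (0 : F))).congr_of_eventuallyEq ?_
      filter_upwards [(isClosed_tsupport χ).isOpen_compl.mem_nhds hx'] with y hy
      rw [image_eq_zero_of_notMem_tsupport hy, zero_smul]
  · filter_upwards [χ.eventuallyEq_one] with y hy
    simp [hy]

/-- An involutive distribution, given as the range of a smooth family `S` of injective linear maps,
is spanned near any point by commuting vector fields: normalise `S` so that a fixed projection `π`
sends it to the identity. The brackets of the normalised fields lie in the distribution and are
killed by `π`, which is injective there. -/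
theorem exists_commuting_frame {V E : Type} [NormedAddCommGroup V] [NormedSpace ℝ V]
    [FiniteDimensional ℝ V] [NormedAddCommGroup E] [NormedSpace ℝ E] [FiniteDimensional ℝ E]
    {O : Set E} (hO : IsOpen O) {S : E → V →L[ℝ] E} (hS : ContDiffOn ℝ ∞ S O) {z₀ : E}
    (hz₀ : z₀ ∈ O) (hinj : Function.Injective (S z₀))
    (hinv : ∀ z ∈ O, ∀ e f : V, ∃ g : V,
      fderiv ℝ S z (S z e) f - fderiv ℝ S z (S z f) e = S z g) :
    ∃ X : E → V →L[ℝ] E, ContDiff ℝ ∞ X ∧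
      (∀ᶠ z in 𝓝 z₀, ∀ e f : V, fderiv ℝ X z (X z e) f = fderiv ℝ X z (X z f) e) ∧
      ∀ᶠ z in 𝓝 z₀, (X z).range = (S z).range := by
  have : CompleteSpace V := FiniteDimensional.complete ℝ V
  obtain ⟨π₀, hπ₀⟩ := (S z₀ : V →ₗ[ℝ] E).exists_leftInverse_of_injective
    (LinearMap.ker_eq_bot.2 hinj)
  set π : E →L[ℝ] V := LinearMap.toContinuousLinearMap π₀
  have hπ : π ∘L S z₀ = ContinuousLinearMap.id ℝ V :=
    ContinuousLinearMap.ext fun x => LinearMap.congr_fun hπ₀ x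
  set B : E → V →L[ℝ] V := fun z => π ∘L S z with hB
  have hBs : ContDiffOn ℝ ∞ B O := contDiffOn_const.clm_comp hS
  set O' : Set E := O ∩ B ⁻¹' range ContinuousLinearEquiv.toContinuousLinearMap with hO'
  have hO'o : IsOpen O' := hBs.continuousOn.isOpen_inter_preimage hO ContinuousLinearEquiv.isOpen
  have hz₀' : z₀ ∈ O' := ⟨hz₀, ContinuousLinearEquiv.refl ℝ V, hπ.symm⟩
  set A : E → V →L[ℝ] V := fun z => (B z).inverse with hA
  have hAs : ContDiffOn ℝ ∞ A O' := by
    intro z hz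
    obtain ⟨e, he⟩ := hz.2
    have h1 : ContDiffAt ℝ ∞ ContinuousLinearMap.inverse (B z) := he ▸ contDiffAt_map_inverse e
    exact (h1.comp z (hBs.contDiffAt (hO.mem_nhds hz.1))).contDiffWithinAt
  have hBA : ∀ z ∈ O', ∀ x, π (S z (A z x)) = x := by
    intro z hz x
    obtain ⟨e, he⟩ := hz.2
    have h1 : B z (A z x) = x := by
      rw [hA]
      simp only
      rw [← he, ContinuousLinearMap.inverse_equiv]
      exact e.apply_symm_apply x
    exact h1
  have hAB : ∀ z ∈ O', ∀ x, A z (π (S z x)) = x := by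
    intro z hz x
    obtain ⟨e, he⟩ := hz.2
    have h1 : A z (B z x) = x := by
      rw [hA]
      simp only
      rw [← he, ContinuousLinearMap.inverse_equiv]
      exact e.symm_apply_apply x
    exact h1
  set X₀ : E → V →L[ℝ] E := fun z => S z ∘L A z with hX₀
  have hX₀s : ContDiffOn ℝ ∞ X₀ O' := (hS.mono inter_subset_left).clm_comp hAs
  have hX₀comm : ∀ z ∈ O', ∀ e f : V,
      fderiv ℝ X₀ z (X₀ z e) f = fderiv ℝ X₀ z (X₀ z f) e := by
    intro z hz e f
    have hSd : HasFDerivAt S (fderiv ℝ S z) z :=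
      ((hS.contDiffAt (hO.mem_nhds hz.1)).differentiableAt (by simp)).hasFDerivAt
    have hAd : HasFDerivAt A (fderiv ℝ A z) z :=
      ((hAs.contDiffAt (hO'o.mem_nhds hz)).differentiableAt (by simp)).hasFDerivAt
    have hXd : HasFDerivAt X₀ (fderiv ℝ X₀ z) z :=
      ((hX₀s.contDiffAt (hO'o.mem_nhds hz)).differentiableAt (by simp)).hasFDerivAt
    have hXv : ∀ v x, fderiv ℝ X₀ z v x = fderiv ℝ S z v (A z x) + S z (fderiv ℝ A z v x) := by
      intro v x
      rw [hXd.unique (hSd.clm_comp hAd)]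
      simp [add_comm]
    have hπX : ∀ v x, π (fderiv ℝ X₀ z v x) = 0 := by
      intro v x
      have h1 : HasFDerivAt (fun y => π (X₀ y x))
          (π ∘L (ContinuousLinearMap.apply ℝ E x) ∘L fderiv ℝ X₀ z) z :=
        π.hasFDerivAt.comp z ((ContinuousLinearMap.apply ℝ E x).hasFDerivAt.comp z hXd)
      have h2 : HasFDerivAt (fun y => π (X₀ y x)) (0 : E →L[ℝ] V) z := by
        refine (hasFDerivAt_const x z).congr_of_eventuallyEq ?_
        filter_upwards [hO'o.mem_nhds hz] with y hy using hBA y hy x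
      exact DFunLike.congr_fun (h1.unique h2) v
    obtain ⟨g, hg⟩ := hinv z hz.1 (A z e) (A z f)
    have h1 : fderiv ℝ X₀ z (X₀ z e) f - fderiv ℝ X₀ z (X₀ z f) e =
        S z (g + fderiv ℝ A z (X₀ z e) f - fderiv ℝ A z (X₀ z f) e) := by
      rw [hXv, hXv, map_sub, map_add, ← hg]
      simp only [hX₀, ContinuousLinearMap.comp_apply]
      abel
    have h2 := congrArg π h1
    rw [map_sub, hπX, hπX, sub_zero] at h2
    have h3 := hAB z hz (g + fderiv ℝ A z (X₀ z e) f - fderiv ℝ A z (X₀ z f) e)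
    rw [← h2, map_zero] at h3
    rw [← h3, map_zero] at h1
    exact sub_eq_zero.1 h1
  obtain ⟨X, hXs, hX⟩ := exists_contDiff_eventuallyEq hO'o hX₀s hz₀'
  refine ⟨X, hXs, ?_, ?_⟩
  · filter_upwards [hX.eventuallyEq_nhds, hO'o.mem_nhds hz₀'] with z hz hzO e f
    rw [hz.fderiv_eq, hz.eq_of_nhds]
    exact hX₀comm z hzO e f
  · filter_upwards [hX, hO'o.mem_nhds hz₀'] with z hz hzO
    rw [hz]
    ext v
    constructor
    · rintro ⟨x, rfl⟩
      exact ⟨A z x, rfl⟩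
    · rintro ⟨x, rfl⟩
      exact ⟨π (S z x), congrArg (S z) (hAB z hzO x)⟩

/-- **Frobenius' theorem**, in flow form: the distribution spanned by a frame in involution has,
near any point, a smooth map `Φ (x, y)` with `Φ (0, y) = y` whose partial maps in `x` are
tangent to the distribution and have the distribution as the range of their derivative. -/
theorem exists_frobenius_flow {N m : ℕ} {O : Set (EuclideanSpace ℝ (Fin N))} (hO : IsOpen O)
    {s : Fin m → EuclideanSpace ℝ (Fin N) → EuclideanSpace ℝ (Fin N)}
    (hframe : IsPartialFrame O s) (hinv : IsInInvolution O s) {z₀ : EuclideanSpace ℝ (Fin N)}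
    (hz₀ : z₀ ∈ O) :
    ∃ (D : Set ((Fin m → ℝ) × EuclideanSpace ℝ (Fin N)))
      (Φ : (Fin m → ℝ) × EuclideanSpace ℝ (Fin N) → EuclideanSpace ℝ (Fin N)),
      IsOpen D ∧ (0, z₀) ∈ D ∧ ContDiffOn ℝ ∞ Φ D ∧ (∀ y, (0, y) ∈ D → Φ (0, y) = y) ∧
      (∀ q ∈ D, Φ q ∈ O) ∧
      ∀ q ∈ D, (fderiv ℝ Φ q ∘L ContinuousLinearMap.inl ℝ _ _).range =
        Submodule.span ℝ (range fun i => s i (Φ q)) := by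
  set S : EuclideanSpace ℝ (Fin N) → (Fin m → ℝ) →L[ℝ] EuclideanSpace ℝ (Fin N) := fun z =>
    ∑ i, (ContinuousLinearMap.proj (R := ℝ) (φ := fun _ : Fin m => ℝ) i).smulRight (s i z)
    with hSdef
  have hSa : ∀ z x, S z x = ∑ i, x i • s i z := by
    intro z x
    simp [hSdef]
  have hS : ContDiffOn ℝ ∞ S O :=
    ContDiffOn.sum fun i _ => contDiffOn_const.smulRight (hframe.smooth i)
  have hSrange : ∀ z, (S z).range = Submodule.span ℝ (range fun i => s i z) := by
    intro z
    ext v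
    rw [Submodule.mem_span_range_iff_exists_fun]
    simp [hSa]
  have hSd : ∀ z ∈ O, ∀ v x, fderiv ℝ S z v x = ∑ i, x i • fderiv ℝ (s i) z v := by
    intro z hz v x
    have h1 : HasFDerivAt S (fderiv ℝ S z) z :=
      ((hS.contDiffAt (hO.mem_nhds hz)).differentiableAt (by simp)).hasFDerivAt
    have h2 := h1.clm_apply (hasFDerivAt_const x z)
    have h3 : HasFDerivAt (fun y => S y x) (∑ i, x i • fderiv ℝ (s i) z) z := by
      simp only [hSa]
      refine HasFDerivAt.fun_sum fun i _ => HasFDerivAt.fun_const_smul ?_ _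
      exact (((hframe.smooth i).contDiffAt (hO.mem_nhds hz)).differentiableAt
        (by simp)).hasFDerivAt
    have := DFunLike.congr_fun (h2.unique h3) v
    simpa using this
  obtain ⟨X, hXs, hXc, hXr⟩ := exists_commuting_frame hO hS hz₀ (by
    intro x y hxy
    rw [hSa, hSa] at hxy
    have := Fintype.linearIndependent_iff.1 (hframe.independent z₀ hz₀) (fun i => x i - y i)
      (by simp [sub_smul, hxy])
    exact funext fun i => sub_eq_zero.1 (this i)) (by
    intro z hz e f
    choose c _ hc using hinv
    refine ⟨fun k => ∑ i, ∑ j, e i * f j * c i j k z, ?_⟩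
    rw [hSd z hz, hSd z hz, hSa, hSa, hSa]
    have hb : ∀ i j, fderiv ℝ (s j) z (s i z) - fderiv ℝ (s i) z (s j z) =
        ∑ k, c i j k z • s k z := fun i j => hc i j z hz
    calc (∑ j, f j • fderiv ℝ (s j) z (∑ i, e i • s i z)) -
          ∑ i, e i • fderiv ℝ (s i) z (∑ j, f j • s j z)
        = ∑ i, ∑ j, (e i * f j) •
            (fderiv ℝ (s j) z (s i z) - fderiv ℝ (s i) z (s j z)) := by
          simp only [map_sum, map_smul, Finset.smul_sum, smul_sub, Finset.sum_sub_distrib,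
            smul_smul]
          congr 1
          rw [Finset.sum_comm]
          simp only [mul_comm]
      _ = ∑ k, (∑ i, ∑ j, e i * f j * c i j k z) • s k z := by
          simp only [hb, Finset.smul_sum, smul_smul, Finset.sum_smul]
          symm
          rw [Finset.sum_comm]
          exact Finset.sum_congr rfl fun i _ => Finset.sum_comm)
  obtain ⟨D, Φ, hDo, hD, hΦs, hΦ0, hΦd⟩ := exists_commuting_flow ⟨X, hXs.continuous⟩ hXs hXc
  obtain ⟨W, hW, hWo, hzW⟩ := eventually_nhds_iff.1 (hXr.and (hO.mem_nhds hz₀))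
  refine ⟨D ∩ Φ ⁻¹' W, Φ, hΦs.continuousOn.isOpen_inter_preimage hDo hWo, ⟨hD, ?_⟩,
    hΦs.mono inter_subset_left, fun y hy => hΦ0 y hy.1, fun q hq => (hW _ hq.2).2, ?_⟩
  · rw [mem_preimage, hΦ0 z₀ hD]
    exact hzW
  · intro q hq
    rw [← hSrange, ← (hW _ hq.2).1]
    congr 1
    exact LinearMap.ext fun e => hΦd q hq.1 e

/-! ### Slice charts and tangent vectors -/

/-- `Ψ` is a chart with smooth inverse that straightens `S`: inside its domain, `S` is the zero
set of the second component. The model space `A × B` is arbitrary. -/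
structure IsSliceChart {E A B : Type*} [NormedAddCommGroup E] [NormedSpace ℝ E]
    [NormedAddCommGroup A] [NormedSpace ℝ A] [NormedAddCommGroup B] [NormedSpace ℝ B]
    (Ψ : OpenPartialHomeomorph E (A × B)) (S : Set E) : Prop where
  smooth : ContDiffOn ℝ ∞ Ψ Ψ.source
  smooth_symm : ContDiffOn ℝ ∞ Ψ.symm Ψ.target
  mem_iff : ∀ x ∈ Ψ.source, x ∈ S ↔ (Ψ x).2 = 0

/-- Coordinates on `ℝ^(k+p)` whose second component vanishes exactly where the last `p` standard
coordinates do. -/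
theorem exists_tail_splitting (k p : ℕ) :
    ∃ L : EuclideanSpace ℝ (Fin (k + p)) ≃L[ℝ] (Fin k → ℝ) × (Fin p → ℝ),
      ∀ v, (L v).2 = 0 ↔ ∀ i : Fin (k + p), k ≤ (i : ℕ) → v i = 0 := by
  let L₀ : EuclideanSpace ℝ (Fin (k + p)) ≃ₗ[ℝ] (Fin k → ℝ) × (Fin p → ℝ) :=
    ((WithLp.linearEquiv 2 ℝ (Fin (k + p) → ℝ)).trans
      (LinearEquiv.funCongrLeft ℝ ℝ finSumFinEquiv)).trans
        (LinearEquiv.sumArrowLequivProdArrow (Fin k) (Fin p) ℝ ℝ)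
  have h2 : ∀ v j, (L₀ v).2 j = v (Fin.natAdd k j) := fun v j => by
    simp [L₀, LinearEquiv.funCongrLeft]
  refine ⟨L₀.toContinuousLinearEquiv, fun v => ⟨fun h i hi => ?_, fun h => funext fun j => ?_⟩⟩
  · obtain ⟨j, rfl⟩ : ∃ j, Fin.natAdd k j = i :=
      ⟨⟨i - k, by omega⟩, Fin.ext (by simp; omega)⟩
    rw [← h2]
    exact congrFun h j
  · exact (h2 v j).trans (h _ (by simp))

theorem IsEmbeddedSubmanifold.exists_isSliceChart {k p N : ℕ} (hN : k + p = N)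
    {S : Set (EuclideanSpace ℝ (Fin N))} (hS : IsEmbeddedSubmanifold k S)
    {z : EuclideanSpace ℝ (Fin N)} (hz : z ∈ S) :
    ∃ Ψ : OpenPartialHomeomorph (EuclideanSpace ℝ (Fin N)) ((Fin k → ℝ) × (Fin p → ℝ)),
      z ∈ Ψ.source ∧ IsSliceChart Ψ S := by
  subst hN
  obtain ⟨φ, hzφ, h1, h2, h3⟩ := hS z hz
  obtain ⟨L, hL⟩ := exists_tail_splitting k p
  refine ⟨φ.trans L.toHomeomorph.toOpenPartialHomeomorph, by simpa using hzφ, ?_, ?_, ?_⟩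
  · exact (L.contDiff.comp_contDiffOn h1).mono (by simp)
  · refine (h2.comp (L.symm.contDiff.contDiffOn (s := L.symm ⁻¹' φ.target))
      (fun x hx => hx)).mono (fun x hx => ?_)
    simpa using hx
  · intro x hx
    rw [h3 x (by simpa using hx), ← hL]
    rfl

theorem isEmbeddedSubmanifold_of_isSliceChart {A B : Type*} [NormedAddCommGroup A]
    [NormedSpace ℝ A] [FiniteDimensional ℝ A] [NormedAddCommGroup B] [NormedSpace ℝ B]
    [FiniteDimensional ℝ B] {k p : ℕ} (hA : Module.finrank ℝ A = k) (hB : Module.finrank ℝ B = p)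
    {S : Set (EuclideanSpace ℝ (Fin (k + p)))}
    (h : ∀ z ∈ S, ∃ Ψ : OpenPartialHomeomorph (EuclideanSpace ℝ (Fin (k + p))) (A × B),
      z ∈ Ψ.source ∧ IsSliceChart Ψ S) : IsEmbeddedSubmanifold k S := by
  intro z hz
  obtain ⟨Ψ, hzΨ, hΨ⟩ := h z hz
  obtain ⟨L, hL⟩ := exists_tail_splitting k p
  let eA : A ≃L[ℝ] (Fin k → ℝ) := ContinuousLinearEquiv.ofFinrankEq (by simp [hA])
  let eB : B ≃L[ℝ] (Fin p → ℝ) := ContinuousLinearEquiv.ofFinrankEq (by simp [hB])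
  let M : (A × B) ≃L[ℝ] EuclideanSpace ℝ (Fin (k + p)) := (eA.prodCongr eB).trans L.symm
  refine ⟨Ψ.trans M.toHomeomorph.toOpenPartialHomeomorph, by simpa using hzΨ, ?_, ?_, ?_⟩
  · exact (M.contDiff.comp_contDiffOn hΨ.smooth).mono (by simp)
  · refine (hΨ.smooth_symm.comp (M.symm.contDiff.contDiffOn (s := M.symm ⁻¹' Ψ.target))
      (fun x hx => hx)).mono (fun x hx => ?_)
    simpa using hx
  · intro x hx
    rw [hΨ.mem_iff x (by simpa using hx)]
    change _ ↔ ∀ i : Fin (k + p), k ≤ (i : ℕ) → M (Ψ x) i = 0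
    rw [← hL]
    simp [M]

/-- Being an embedded submanifold is a local property. -/
theorem isEmbeddedSubmanifold_of_local {N k : ℕ} {S : Set (EuclideanSpace ℝ (Fin N))}
    (h : ∀ z ∈ S, ∃ W S', IsOpen W ∧ z ∈ W ∧ IsEmbeddedSubmanifold k S' ∧ S ∩ W = S' ∩ W) :
    IsEmbeddedSubmanifold k S := by
  intro z hz
  obtain ⟨W, S', hW, hzW, hS', hSS'⟩ := h z hz
  have hmem : ∀ x ∈ W, (x ∈ S ↔ x ∈ S') := fun x hx =>
    ⟨fun hxS => (hSS'.subset ⟨hxS, hx⟩).1, fun hxS => (hSS'.superset ⟨hxS, hx⟩).1⟩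
  obtain ⟨φ, hzφ, h1, h2, h3⟩ := hS' z ((hmem z hzW).1 hz)
  refine ⟨φ.restrOpen W hW, ⟨hzφ, hzW⟩, h1.mono inter_subset_left,
    h2.mono (fun x hx => hx.1), fun x hx => ?_⟩
  rw [hmem x hx.2]
  exact h3 x hx.1

theorem isEmbeddedSubmanifold_zero_singleton {N : ℕ} (z : EuclideanSpace ℝ (Fin N)) :
    IsEmbeddedSubmanifold 0 {z} := by
  intro x hx
  refine ⟨(Homeomorph.subRight z).toOpenPartialHomeomorph, by simp, ?_, ?_, fun y _ => ?_⟩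
  · exact (contDiff_id.sub contDiff_const).contDiffOn
  · exact (contDiff_id.add contDiff_const).contDiffOn
  · simp only [mem_singleton_iff, Nat.zero_le, forall_const]
    rw [← sub_eq_zero]
    exact ⟨fun h i => by simp [h], fun h => PiLp.ext h⟩

theorem IsVelocityAt.of_inter_subset {N : ℕ} {S W : Set (EuclideanSpace ℝ (Fin N))} (hW : IsOpen W)
    {z v : EuclideanSpace ℝ (Fin N)} (hz : z ∈ W) {S' : Set (EuclideanSpace ℝ (Fin N))}
    (hSS' : S ∩ W ⊆ S') (h : IsVelocityAt S z v) : IsVelocityAt S' z v := by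
  obtain ⟨γ, ε, hε, hγ, hγS, h0, hv⟩ := h
  have hc : ContinuousAt γ 0 := hv.continuousAt
  obtain ⟨δ, hδ, hδW⟩ := Metric.mem_nhds_iff.1 (hc (hW.mem_nhds (h0 ▸ hz)))
  rw [Real.ball_eq_Ioo, zero_sub, zero_add] at hδW
  have hsub : Ioo (-min ε δ) (min ε δ) ⊆ Ioo (-ε) ε :=
    Ioo_subset_Ioo (neg_le_neg (min_le_left _ _)) (min_le_left _ _)
  exact ⟨γ, min ε δ, lt_min hε hδ, hγ.mono hsub,
    fun t ht => hSS' ⟨hγS t (hsub ht),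
      hδW (Ioo_subset_Ioo (neg_le_neg (min_le_right _ _)) (min_le_right _ _) ht)⟩, h0, hv⟩

theorem tangentSpaceOf_mono_local {N : ℕ} {S S' W : Set (EuclideanSpace ℝ (Fin N))}
    (hW : IsOpen W) {z : EuclideanSpace ℝ (Fin N)} (hz : z ∈ W) (hSS' : S ∩ W ⊆ S') :
    tangentSpaceOf S z ≤ tangentSpaceOf S' z :=
  Submodule.span_mono fun _ hv => IsVelocityAt.of_inter_subset hW hz hSS' hv

/-- A smooth map into `S`, defined near `q`, maps tangent vectors to tangent vectors. -/
theorem fderiv_mem_tangentSpaceOf {G : Type*} [NormedAddCommGroup G] [NormedSpace ℝ G] {N : ℕ}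
    {S : Set (EuclideanSpace ℝ (Fin N))} {f : G → EuclideanSpace ℝ (Fin N)} {U : Set G}
    (hU : IsOpen U) (hf : ContDiffOn ℝ ∞ f U) {q : G} (hq : q ∈ U) {v : G}
    (hfS : ∀ t : ℝ, q + t • v ∈ U → f (q + t • v) ∈ S) :
    fderiv ℝ f q v ∈ tangentSpaceOf S (f q) := by
  have hl : ContDiff ℝ ∞ fun t : ℝ => q + t • v :=
    contDiff_const.add (contDiff_id.smul contDiff_const)
  have hlU : IsOpen ((fun t : ℝ => q + t • v) ⁻¹' U) := hU.preimage hl.continuous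
  obtain ⟨ε, hε, hεU⟩ := Metric.isOpen_iff.1 hlU 0 (by simpa using hq)
  rw [Real.ball_eq_Ioo, zero_sub, zero_add] at hεU
  refine Submodule.subset_span ⟨fun t => f (q + t • v), ε, hε, ?_, fun t ht => hfS t (hεU ht),
    by simp, ?_⟩
  · exact hf.comp hl.contDiffOn hεU
  · have h1 : HasDerivAt (fun t : ℝ => q + t • v) v 0 := by
      simpa using ((hasDerivAt_id' (0:ℝ)).smul_const v).const_add q
    have h2 : HasFDerivAt f (fderiv ℝ f q) (q + (0:ℝ) • v) := by
      simpa using ((hf.contDiffAt (hU.mem_nhds hq)).differentiableAt (by simp)).hasFDerivAt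
    exact h2.comp_hasDerivAt 0 h1

/-- Tangent vectors are annihilated by the equations of a slice chart. -/
theorem IsSliceChart.fderiv_snd_eq_zero {A B : Type*} [NormedAddCommGroup A] [NormedSpace ℝ A]
    [NormedAddCommGroup B] [NormedSpace ℝ B] {N : ℕ} {S : Set (EuclideanSpace ℝ (Fin N))}
    {Ψ : OpenPartialHomeomorph (EuclideanSpace ℝ (Fin N)) (A × B)} (hΨ : IsSliceChart Ψ S)
    {z v : EuclideanSpace ℝ (Fin N)} (hz : z ∈ Ψ.source) (hv : v ∈ tangentSpaceOf S z) :
    (fderiv ℝ Ψ z v).2 = 0 := by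
  suffices h : tangentSpaceOf S z ≤ (ContinuousLinearMap.snd ℝ A B ∘L fderiv ℝ Ψ z).ker from
    h hv
  refine Submodule.span_le.2 ?_
  rintro v ⟨γ, ε, hε, -, hγS, rfl, hγ⟩
  have h1 : HasFDerivAt Ψ (fderiv ℝ Ψ (γ 0)) (γ 0) :=
    ((hΨ.smooth.contDiffAt (Ψ.open_source.mem_nhds hz)).differentiableAt (by simp)).hasFDerivAt
  have h2 : HasDerivAt (fun t => (Ψ (γ t)).2) ((fderiv ℝ Ψ (γ 0) v).2) 0 :=
    (ContinuousLinearMap.snd ℝ A B).hasFDerivAt.comp_hasDerivAt 0 (h1.comp_hasDerivAt 0 hγ)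
  have h3 : HasDerivAt (fun t => (Ψ (γ t)).2) 0 0 := by
    refine (hasDerivAt_const (0:ℝ) (0 : B)).congr_of_eventuallyEq ?_
    filter_upwards [hγ.continuousAt.preimage_mem_nhds (Ψ.open_source.mem_nhds hz),
      Ioo_mem_nhds (neg_lt_zero.2 hε) hε] with t ht htε
    exact (hΨ.mem_iff _ ht).1 (hγS t htε)
  exact h2.unique h3

/-! ### Submanifolds tangent to a coordinate direction -/

section Slices

variable {V W A B : Type*} [NormedAddCommGroup V] [NormedSpace ℝ V] [NormedAddCommGroup W]
  [NormedSpace ℝ W] [NormedAddCommGroup A] [NormedSpace ℝ A] [NormedAddCommGroup B]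
  [NormedSpace ℝ B]

/-- If the submanifold `{κ.2 = 0}` is tangent to the directions `V` and contains a neighbourhood
of `0` in `W`, then it contains a neighbourhood of `0` in `V × W`. Along a segment in the direction
`V`, the function `κ.2` satisfies a linear differential inequality, because its derivative in the
directions `V` vanishes on `{κ.2 = 0}`. -/
theorem eventually_snd_eq_zero (κ : OpenPartialHomeomorph ((V × W) × B) (A × B))
    (hκ : ContDiffOn ℝ ∞ κ κ.source) (hκ' : ContDiffOn ℝ ∞ κ.symm κ.target)
    (h0 : (0 : (V × W) × B) ∈ κ.source)
    (htan : ∀ q ∈ κ.source, (κ q).2 = 0 → ∀ e : V, (fderiv ℝ κ q ((e, 0), 0)).2 = 0)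
    (hW : ∀ᶠ a : W in 𝓝 0, (κ ((0, a), 0)).2 = 0) :
    ∀ᶠ r : V × W in 𝓝 0, (κ (r, 0)).2 = 0 := by
  set ι : V →L[ℝ] (V × W) × B :=
    ContinuousLinearMap.inl ℝ (V × W) B ∘L ContinuousLinearMap.inl ℝ V W with hι
  set M : A × B → V →L[ℝ] B := fun y =>
    ContinuousLinearMap.snd ℝ A B ∘L fderiv ℝ κ (κ.symm y) ∘L ι with hM
  have hκ0 : κ 0 ∈ κ.target := κ.map_source h0
  have h00 : (κ 0).2 = 0 := hW.self_of_nhds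
  have hMs : ContDiffAt ℝ 1 M (κ 0) := by
    have h1 : ContDiffAt ℝ 1 (fderiv ℝ κ) (κ.symm (κ 0)) := by
      rw [κ.left_inv h0]
      have h12 : ((1 + 1 : ℕ∞) : WithTop ℕ∞) ≤ ∞ := by exact_mod_cast le_top
      exact (hκ.contDiffAt (κ.open_source.mem_nhds h0)).fderiv_right (m := 1) h12
    have h2 : ContDiffAt ℝ 1 κ.symm (κ 0) :=
      (hκ'.contDiffAt (κ.open_target.mem_nhds hκ0)).of_le (by exact_mod_cast le_top)
    exact contDiffAt_const.clm_comp ((h1.comp _ h2).clm_comp contDiffAt_const)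
  obtain ⟨K, t, ht, hK⟩ := hMs.exists_lipschitzOnWith
  -- the derivative in the directions `V` is bounded by the function itself
  have hbound : ∀ᶠ q in 𝓝 (0 : (V × W) × B), q ∈ κ.source ∧
      ∀ e : V, ‖(fderiv ℝ κ q ((e, 0), 0)).2‖ ≤ K * ‖(κ q).2‖ * ‖e‖ := by
    have hc : ContinuousAt κ 0 := κ.continuousAt h0
    have hc' : ContinuousAt (fun q => ((κ q).1, (0 : B))) 0 :=
      (continuous_fst.continuousAt.comp hc).prodMk continuousAt_const
    have hc'0 : ((κ 0).1, (0 : B)) = κ 0 := Prod.ext rfl h00.symm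
    filter_upwards [κ.open_source.mem_nhds h0, hc.preimage_mem_nhds ht,
      hc'.preimage_mem_nhds (hc'0.symm ▸ ht),
      hc'.preimage_mem_nhds (hc'0.symm ▸ κ.open_target.mem_nhds hκ0)] with q hq hqt hqt' hqT
    refine ⟨hq, fun e => ?_⟩
    -- `((κ q).1, 0)` represents a point of the submanifold, where the tangency applies
    have hM0 : M ((κ q).1, 0) = 0 := by
      ext e
      exact htan _ (κ.map_target hqT) (by rw [κ.right_inv hqT]) e
    have h1 := hK.norm_sub_le hqt hqt'
    have h2 : κ q - ((κ q).1, 0) = (0, (κ q).2) := Prod.ext (by simp) (by simp)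
    rw [hM0, sub_zero, h2, Prod.norm_mk, norm_zero, max_eq_right (norm_nonneg _)] at h1
    have h3 : M (κ q) e = (fderiv ℝ κ q ((e, 0), 0)).2 := by
      simp [hM, hι, κ.left_inv hq]
    rw [← h3]
    exact (M (κ q)).le_of_opNorm_le h1 e
  obtain ⟨r, hr, hball⟩ := Metric.eventually_nhds_iff_ball.1 hbound
  have hball' : ∀ᶠ p : V × W in 𝓝 0, p ∈ Metric.ball (0 : V × W) r :=
    Metric.ball_mem_nhds _ hr
  have hW' : ∀ᶠ p : V × W in 𝓝 0, (κ ((0, p.2), 0)).2 = 0 :=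
    (continuous_snd.tendsto (0 : V × W)).eventually hW
  filter_upwards [hball', hW'] with p hp hp0
  have hin : ∀ τ ∈ Icc (0:ℝ) 1, ((τ • p.1, p.2), (0:B)) ∈ Metric.ball (0 : (V × W) × B) r := by
    intro τ hτ
    rw [mem_ball_zero_iff] at hp ⊢
    refine lt_of_le_of_lt ?_ hp
    rw [Prod.norm_mk, norm_zero, max_eq_left (norm_nonneg _), Prod.norm_mk, Prod.norm_def,
      norm_smul, Real.norm_of_nonneg hτ.1]
    exact max_le_max (mul_le_of_le_one_left (norm_nonneg _) hτ.2) le_rfl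
  set g : ℝ → B := fun τ => (κ ((τ • p.1, p.2), 0)).2 with hg
  have hgd : ∀ τ ∈ Icc (0:ℝ) 1,
      HasDerivAt g ((fderiv ℝ κ ((τ • p.1, p.2), 0) ((p.1, 0), 0)).2) τ := by
    intro τ hτ
    have h1 : HasFDerivAt κ (fderiv ℝ κ ((τ • p.1, p.2), 0)) ((τ • p.1, p.2), 0) :=
      ((hκ.contDiffAt (κ.open_source.mem_nhds (hball _ (hin τ hτ)).1)).differentiableAt
        (by simp)).hasFDerivAt
    have h2 : HasDerivAt (fun τ : ℝ => ((τ • p.1, p.2), (0:B))) ((p.1, 0), 0) τ := by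
      have h3 : HasDerivAt (fun τ : ℝ => τ • p.1) p.1 τ := by
        simpa using (hasDerivAt_id' τ).smul_const p.1
      exact (h3.prodMk (hasDerivAt_const τ p.2)).prodMk (hasDerivAt_const τ 0)
    exact (ContinuousLinearMap.snd ℝ A B).hasFDerivAt.comp_hasDerivAt τ (h1.comp_hasDerivAt τ h2)
  have := eq_zero_of_abs_deriv_le_mul_abs_self_of_eq_zero_right (f := g) (K := K * ‖p.1‖)
    (a := 0) (b := 1) (fun τ hτ => (hgd τ hτ).continuousAt.continuousWithinAt)
    (fun τ hτ => (hgd τ (Ico_subset_Icc_self hτ)).hasDerivWithinAt)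
    (by simpa [hg] using hp0)
    (fun τ hτ => ((hball _ (hin τ (Ico_subset_Icc_self hτ))).2 p.1).trans_eq (by ring))
    1 (by simp)
  simpa [hg] using this

/-- A submanifold `{κ.2 = 0}` which contains the slice `{q.2 = 0}` of the same dimension agrees
with it near `0`. -/
theorem eventually_snd_eq_zero_iff [FiniteDimensional ℝ B]
    (κ : OpenPartialHomeomorph (V × B) (A × B))
    (hκ : ContDiffOn ℝ ∞ κ κ.source) (hκ' : ContDiffOn ℝ ∞ κ.symm κ.target)
    (h0 : (0 : V × B) ∈ κ.source) (hV : ∀ᶠ r : V in 𝓝 0, (κ (r, 0)).2 = 0) :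
    ∀ᶠ q : V × B in 𝓝 0, (κ q).2 = 0 ↔ q.2 = 0 := by
  have hs : HasStrictFDerivAt κ (fderiv ℝ κ 0) 0 :=
    (hκ.contDiffAt (κ.open_source.mem_nhds h0)).hasStrictFDerivAt (by simp)
  set G : V × B → B := fun q => (κ q).2 with hG
  set G' : V × B →L[ℝ] B := ContinuousLinearMap.snd ℝ A B ∘L fderiv ℝ κ 0 with hG'
  have hGs : HasStrictFDerivAt G G' 0 :=
    (ContinuousLinearMap.snd ℝ A B).hasStrictFDerivAt.comp 0 hs
  have hG'V : ∀ v, G' (v, 0) = 0 := by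
    intro v
    have h1 : HasFDerivAt (fun r : V => G (r, 0)) (G' ∘L ContinuousLinearMap.inl ℝ V B) 0 :=
      HasFDerivAt.comp (f := fun r : V => (r, (0:B))) 0 hGs.hasFDerivAt
        (ContinuousLinearMap.inl ℝ V B).hasFDerivAt
    have h2 : HasFDerivAt (fun r : V => G (r, 0)) (0 : V →L[ℝ] B) 0 :=
      (hasFDerivAt_const (0 : B) _).congr_of_eventuallyEq hV
    exact DFunLike.congr_fun (h1.unique h2) v
  set T : B →ₗ[ℝ] B := (G' ∘L ContinuousLinearMap.inr ℝ V B).toLinearMap with hT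
  -- `G'` is onto because the derivative of `κ` is, and it vanishes on `V`
  have hTsurj : Function.Surjective T := by
    intro b
    have h1 : HasFDerivAt κ (fderiv ℝ κ 0) (κ.symm (κ 0)) := by
      rw [κ.left_inv h0]; exact hs.hasFDerivAt
    have h2 : HasFDerivAt κ.symm (fderiv ℝ κ.symm (κ 0)) (κ 0) :=
      ((hκ'.contDiffAt (κ.open_target.mem_nhds (κ.map_source h0))).differentiableAt
        (by simp)).hasFDerivAt
    have h3 : HasFDerivAt (fun y => κ (κ.symm y)) (ContinuousLinearMap.id ℝ (A × B)) (κ 0) := by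
      refine (hasFDerivAt_id (κ 0)).congr_of_eventuallyEq ?_
      filter_upwards [κ.open_target.mem_nhds (κ.map_source h0)] with y hy using κ.right_inv hy
    have h4 := DFunLike.congr_fun ((h1.comp (κ 0) h2).unique h3) (0, b)
    set w := fderiv ℝ κ.symm (κ 0) (0, b) with hw
    refine ⟨w.2, ?_⟩
    have h5 : G' w = b := congrArg Prod.snd h4
    have h6 : w = (w.1, 0) + (0, w.2) := by simp
    rw [h6, map_add, hG'V, zero_add] at h5
    exact h5
  have hTinj : LinearMap.ker T = ⊥ :=
    LinearMap.ker_eq_bot.2 (LinearMap.injective_iff_surjective.2 hTsurj)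
  obtain ⟨K, hK, hTK⟩ := T.exists_antilipschitzWith hTinj
  have hKpos : (0:ℝ) < K := hK
  have hlittle := (hGs.isLittleO.def (c := (K:ℝ)⁻¹ / 2) (by positivity))
  have htend : Tendsto (fun q : V × B => (q, (q.1, (0:B)))) (𝓝 0) (𝓝 (0, 0)) := by
    have : Continuous fun q : V × B => (q, (q.1, (0:B))) := by fun_prop
    exact this.tendsto' _ _ rfl
  filter_upwards [htend.eventually hlittle, (continuous_fst.tendsto (0 : V × B)).eventually hV]
    with q hq hq1
  have hG1 : G (q.1, 0) = 0 := hq1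
  constructor
  · intro h
    have hG0 : G q = 0 := h
    have h1 : q - (q.1, 0) = (0, q.2) := Prod.ext (by simp) (by simp)
    simp only [hG0, hG1, h1, sub_zero, zero_sub, norm_neg, Prod.norm_mk, norm_zero] at hq
    rw [max_eq_right (norm_nonneg _)] at hq
    have h2 : ‖q.2‖ ≤ K * ‖T q.2‖ := by
      have := hTK.le_mul_dist q.2 0
      simpa using this
    have h3 : ‖T q.2‖ ≤ (K:ℝ)⁻¹ / 2 * ‖q.2‖ := hq
    have h4 : ‖q.2‖ ≤ K * ((K:ℝ)⁻¹ / 2 * ‖q.2‖) := h2.trans (by gcongr)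
    have h5 : (K:ℝ) * ((K:ℝ)⁻¹ / 2 * ‖q.2‖) = ‖q.2‖ / 2 := by field_simp
    rw [h5] at h4
    exact norm_le_zero_iff.1 (by linarith)
  · intro h
    have h1 : q = (q.1, 0) := Prod.ext rfl h
    rw [h1]
    exact hq1

end Slices

/-! ### Adapted coordinates -/

/-- Three independent linear maps whose dimensions add up to that of the target form an
isomorphism from the product. -/
theorem exists_equiv_of_disjoint {V W B E : Type*} [NormedAddCommGroup V] [NormedSpace ℝ V]
    [FiniteDimensional ℝ V] [NormedAddCommGroup W] [NormedSpace ℝ W] [FiniteDimensional ℝ W]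
    [NormedAddCommGroup B] [NormedSpace ℝ B] [FiniteDimensional ℝ B] [NormedAddCommGroup E]
    [NormedSpace ℝ E] [FiniteDimensional ℝ E] {P : V →L[ℝ] E} {T : W →L[ℝ] E}
    (hP : Function.Injective P) (hT : Function.Injective T) (hPT : Disjoint P.range T.range)
    (hdim : Module.finrank ℝ V + Module.finrank ℝ W + Module.finrank ℝ B = Module.finrank ℝ E) :
    ∃ (R : B →L[ℝ] E) (e : ((V × W) × B) ≃L[ℝ] E), ∀ v w b, e ((v, w), b) = P v + T w + R b := by
  set Q : V × W →L[ℝ] E := P.coprod T with hQ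
  have hQinj : Function.Injective Q := by
    refine (injective_iff_map_eq_zero Q).2 fun ⟨v, w⟩ h => ?_
    have h1 : P v = T (-w) := by
      rw [map_neg]
      exact eq_neg_of_add_eq_zero_left (by simpa [hQ] using h)
    have h2 : P v = 0 := Submodule.disjoint_def.1 hPT _ ⟨v, rfl⟩ ⟨-w, h1.symm⟩
    have h3 : T w = 0 := by simpa [h2, eq_comm] using h1
    exact Prod.ext (hP (by simpa using h2)) (hT (by simpa using h3))
  obtain ⟨C, hC⟩ := Submodule.exists_isCompl Q.range
  have hQr : Module.finrank ℝ Q.range = Module.finrank ℝ V + Module.finrank ℝ W := by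
    rw [← Module.finrank_prod]
    exact LinearMap.finrank_range_of_inj hQinj
  have hCr : Module.finrank ℝ B = Module.finrank ℝ C := by
    have := Submodule.finrank_add_eq_of_isCompl hC
    omega
  let r : B ≃L[ℝ] C := ContinuousLinearEquiv.ofFinrankEq hCr
  set R : B →L[ℝ] E := C.subtypeL ∘L (r : B →L[ℝ] C) with hR
  have hinj : Function.Injective (Q.coprod R) := by
    refine (injective_iff_map_eq_zero (Q.coprod R)).2 fun ⟨q, b⟩ h => ?_
    have h1 : Q q = -(r b : E) := eq_neg_of_add_eq_zero_left (by simpa [hR] using h)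
    have h2 : Q q = 0 := Submodule.disjoint_def.1 hC.disjoint _ ⟨q, rfl⟩
      (h1 ▸ C.neg_mem (r b).2)
    have h3 : r b = 0 := by
      rw [h2, eq_comm, neg_eq_zero] at h1
      exact Subtype.ext h1
    exact Prod.ext (hQinj (by simpa using h2)) (r.injective (by simpa using h3))
  let e₀ := (LinearMap.linearEquivOfInjective (Q.coprod R).toLinearMap hinj
    (by rw [Module.finrank_prod, Module.finrank_prod, hdim])).toContinuousLinearEquiv
  exact ⟨R, e₀, fun v w b => rfl⟩

/-- Near a point `z₀` of a submanifold `Λ` transverse to an involutive distribution there are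
coordinates `((x, a), b)` in which the distribution is spanned by the directions `x`, and `Λ` is
the set `x = 0`, `b = 0`. They are obtained by flowing along the distribution, for the parameter
`x`, from the point of parameter `a` on `Λ` shifted by a vector `b` of a complement. -/
theorem exists_adapted_chart {N m k p : ℕ} (hN : m + k + p = N)
    {O : Set (EuclideanSpace ℝ (Fin N))} (hO : IsOpen O)
    {s : Fin m → EuclideanSpace ℝ (Fin N) → EuclideanSpace ℝ (Fin N)}
    (hframe : IsPartialFrame O s) (hinv : IsInInvolution O s)
    {Λ : Set (EuclideanSpace ℝ (Fin N))} (hΛ : IsEmbeddedSubmanifold k Λ)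
    {z₀ : EuclideanSpace ℝ (Fin N)} (hz₀O : z₀ ∈ O) (hz₀ : z₀ ∈ Λ)
    (hdisj : Disjoint (Submodule.span ℝ (range fun i => s i z₀)) (tangentSpaceOf Λ z₀)) :
    ∃ Θ : OpenPartialHomeomorph (((Fin m → ℝ) × (Fin k → ℝ)) × (Fin p → ℝ))
        (EuclideanSpace ℝ (Fin N)),
      0 ∈ Θ.source ∧ Θ 0 = z₀ ∧ ContDiffOn ℝ ∞ Θ Θ.source ∧ ContDiffOn ℝ ∞ Θ.symm Θ.target ∧
      Θ.target ⊆ O ∧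
      (∀ q ∈ Θ.source, (fderiv ℝ Θ q ∘L ContinuousLinearMap.inl ℝ _ _ ∘L
        ContinuousLinearMap.inl ℝ _ _).range = Submodule.span ℝ (range fun i => s i (Θ q))) ∧
      (∀ a, ((0, a), 0) ∈ Θ.source → Θ ((0, a), 0) ∈ Λ) ∧
      ∃ U, IsOpen U ∧ z₀ ∈ U ∧ ∀ z ∈ Λ ∩ U, ∃ a, ((0, a), 0) ∈ Θ.source ∧ Θ ((0, a), 0) = z := by
  obtain ⟨Ψ, hzΨ, hΨ⟩ := hΛ.exists_isSliceChart (p := m + p) (by omega) hz₀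
  obtain ⟨D, Φ, hDo, hD, hΦs, hΦ0, hΦO, hΦr⟩ := exists_frobenius_flow hO hframe hinv hz₀O
  -- the parametrisation `l` of `Λ`
  set c : (Fin k → ℝ) → (Fin k → ℝ) × (Fin (m + p) → ℝ) := fun a => (a + (Ψ z₀).1, 0) with hc
  have hcs : ContDiff ℝ ∞ c := (contDiff_id.add contDiff_const).prodMk contDiff_const
  set UL : Set (Fin k → ℝ) := c ⁻¹' Ψ.target with hUL
  have hULo : IsOpen UL := Ψ.open_target.preimage hcs.continuous
  have hΨz : ∀ z ∈ Λ ∩ Ψ.source, c ((Ψ z).1 - (Ψ z₀).1) = Ψ z := by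
    intro z hz
    exact Prod.ext (by simp [hc]) ((hΨ.mem_iff z hz.2).1 hz.1).symm
  have hc0 : c 0 = Ψ z₀ := by simpa using hΨz z₀ ⟨hz₀, hzΨ⟩
  have h0UL : (0 : Fin k → ℝ) ∈ UL := by
    rw [hUL, mem_preimage, hc0]
    exact Ψ.map_source hzΨ
  set l : (Fin k → ℝ) → EuclideanSpace ℝ (Fin N) := fun a => Ψ.symm (c a) with hl
  have hls : ContDiffOn ℝ ∞ l UL := hΨ.smooth_symm.comp hcs.contDiffOn fun a ha => ha
  have hl0 : l 0 = z₀ := by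
    rw [hl]
    simp only
    rw [hc0, Ψ.left_inv hzΨ]
  have hlΛ : ∀ a ∈ UL, l a ∈ Λ := fun a ha =>
    (hΨ.mem_iff _ (Ψ.map_target ha)).2 (by rw [Ψ.right_inv ha])
  have hld : HasFDerivAt l (fderiv ℝ l 0) 0 :=
    ((hls.contDiffAt (hULo.mem_nhds h0UL)).differentiableAt (by simp)).hasFDerivAt
  set T := fderiv ℝ l 0 with hT
  have hTrange : T.range ≤ tangentSpaceOf Λ z₀ := by
    rintro _ ⟨v, rfl⟩
    rw [← hl0]
    exact fderiv_mem_tangentSpaceOf hULo hls h0UL fun t ht => hlΛ _ ht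
  have hTinj : Function.Injective T := by
    have h1 : HasFDerivAt Ψ (fderiv ℝ Ψ z₀) (l 0) := by
      rw [hl0]
      exact ((hΨ.smooth.contDiffAt (Ψ.open_source.mem_nhds hzΨ)).differentiableAt
        (by simp)).hasFDerivAt
    have h2 : HasFDerivAt (fun a => (Ψ (l a)).1) (ContinuousLinearMap.id ℝ (Fin k → ℝ)) 0 := by
      refine ((hasFDerivAt_id (0 : Fin k → ℝ)).add_const (Ψ z₀).1).congr_of_eventuallyEq ?_
      filter_upwards [hULo.mem_nhds h0UL] with a ha
      rw [hl]
      simp only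
      rw [Ψ.right_inv ha]
      rfl
    have h3 : HasFDerivAt (fun a => (Ψ (l a)).1)
        (ContinuousLinearMap.fst ℝ _ _ ∘L fderiv ℝ Ψ z₀ ∘L T) 0 :=
      (h1.comp 0 hld).fst
    have h4 := h3.unique h2
    intro v w hvw
    have h5 := DFunLike.congr_fun h4 v
    have h6 := DFunLike.congr_fun h4 w
    simp only [ContinuousLinearMap.comp_apply, ContinuousLinearMap.id_apply] at h5 h6
    rw [← h5, ← h6, hvw]
  -- the derivative of the flow at the base point
  have hΦd : ∀ q ∈ D, HasFDerivAt Φ (fderiv ℝ Φ q) q := fun q hq =>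
    ((hΦs.contDiffAt (hDo.mem_nhds hq)).differentiableAt (by simp)).hasFDerivAt
  set P : (Fin m → ℝ) →L[ℝ] EuclideanSpace ℝ (Fin N) :=
    fderiv ℝ Φ (0, z₀) ∘L ContinuousLinearMap.inl ℝ _ _ with hP
  have hPr : P.range = Submodule.span ℝ (range fun i => s i z₀) := by
    rw [hP, hΦr _ hD, hΦ0 _ hD]
  have hPinj : Function.Injective P := by
    have h1 : Module.finrank ℝ P.range = m := by
      rw [hPr]
      simpa using finrank_span_eq_card (hframe.independent z₀ hz₀O)
    have h2 := P.toLinearMap.finrank_range_add_finrank_ker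
    have h3 : Module.finrank ℝ (LinearMap.ker P.toLinearMap) = 0 := by
      have h4 : Module.finrank ℝ (Fin m → ℝ) = m := by simp
      omega
    exact LinearMap.ker_eq_bot.1 (Submodule.finrank_eq_zero.1 h3)
  have hΦy : ∀ v, fderiv ℝ Φ (0, z₀) (0, v) = v := by
    intro v
    have h1 : HasFDerivAt (fun y => Φ (0, y))
        (fderiv ℝ Φ (0, z₀) ∘L ContinuousLinearMap.inr ℝ _ _) z₀ :=
      HasFDerivAt.comp (f := fun y => ((0 : Fin m → ℝ), y)) z₀ (hΦd _ hD)
        (hasFDerivAt_prodMk_right _ _)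
    have h2 : HasFDerivAt (fun y => Φ (0, y)) (ContinuousLinearMap.id ℝ _) z₀ := by
      refine (hasFDerivAt_id z₀).congr_of_eventuallyEq ?_
      have hc' : Continuous fun y : EuclideanSpace ℝ (Fin N) => ((0 : Fin m → ℝ), y) := by fun_prop
      filter_upwards [(hDo.preimage hc').mem_nhds hD] with y hy using hΦ0 y hy
    exact DFunLike.congr_fun (h1.unique h2) v
  obtain ⟨R, e, he⟩ := exists_equiv_of_disjoint (B := Fin p → ℝ) hPinj hTinj
    (by rw [hPr]; exact hdisj.mono_right hTrange) (by simp [hN])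
  -- the chart
  set ρ : ((Fin m → ℝ) × (Fin k → ℝ)) × (Fin p → ℝ) → (Fin m → ℝ) × EuclideanSpace ℝ (Fin N) :=
    fun q => (q.1.1, l q.1.2 + R q.2) with hρ
  set UT : Set (((Fin m → ℝ) × (Fin k → ℝ)) × (Fin p → ℝ)) := {q | q.1.2 ∈ UL} with hUT
  have hUTo : IsOpen UT := hULo.preimage (by fun_prop)
  have hρs : ContDiffOn ℝ ∞ ρ UT := by
    refine (contDiff_fst.comp contDiff_fst).contDiffOn.prodMk (ContDiffOn.add ?_ ?_)
    · exact hls.comp (contDiff_snd.comp contDiff_fst).contDiffOn fun q hq => hq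
    · exact (R.contDiff.comp contDiff_snd).contDiffOn
  set U' := UT ∩ ρ ⁻¹' D with hU'
  have hU'o : IsOpen U' := hρs.continuousOn.isOpen_inter_preimage hUTo hDo
  have hρ0 : ρ 0 = (0, z₀) := by simp [hρ, hl0]
  have h0U' : 0 ∈ U' := ⟨h0UL, by rw [mem_preimage, hρ0]; exact hD⟩
  have hΘs : ContDiffOn ℝ ∞ (fun q => Φ (ρ q)) U' :=
    hΦs.comp (hρs.mono inter_subset_left) fun q hq => hq.2
  have hρd0 : HasFDerivAt ρ
      ((ContinuousLinearMap.fst ℝ _ _ ∘L ContinuousLinearMap.fst ℝ _ _).prod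
        (T ∘L ContinuousLinearMap.snd ℝ _ _ ∘L ContinuousLinearMap.fst ℝ _ _ +
          R ∘L ContinuousLinearMap.snd ℝ _ _)) 0 := by
    have h1 : HasFDerivAt (fun q : ((Fin m → ℝ) × (Fin k → ℝ)) × (Fin p → ℝ) => l q.1.2)
        (T ∘L (ContinuousLinearMap.snd ℝ _ _ ∘L ContinuousLinearMap.fst ℝ _ _)) 0 :=
      HasFDerivAt.comp (f := fun q : ((Fin m → ℝ) × (Fin k → ℝ)) × (Fin p → ℝ) => q.1.2) 0 hld
        hasFDerivAt_fst.snd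
    exact (ContinuousLinearMap.fst ℝ _ _ ∘L ContinuousLinearMap.fst ℝ _ _).hasFDerivAt.prodMk
      (h1.add (R ∘L ContinuousLinearMap.snd ℝ _ _).hasFDerivAt)
  have hΘd0 : HasFDerivAt (fun q => Φ (ρ q))
      (e : ((Fin m → ℝ) × (Fin k → ℝ)) × (Fin p → ℝ) →L[ℝ] EuclideanSpace ℝ (Fin N)) 0 := by
    have h1 : HasFDerivAt Φ (fderiv ℝ Φ (0, z₀)) (ρ 0) := by rw [hρ0]; exact hΦd _ hD
    refine (h1.comp 0 hρd0).congr_fderiv ?_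
    refine ContinuousLinearMap.ext fun ⟨⟨v, w⟩, b⟩ => ?_
    have h2 : fderiv ℝ Φ (0, z₀) (v, T w + R b) = P v + (T w + R b) := by
      rw [← hΦy (T w + R b), hP, ContinuousLinearMap.comp_apply, ← map_add, hΦy]
      simp
    change fderiv ℝ Φ (0, z₀) (v, T w + R b) = e ((v, w), b)
    rw [h2, he, add_assoc]
  obtain ⟨Θ, h0Θ, hΘU, hΘ, hΘsymm⟩ := exists_smooth_localInverse hU'o hΘs h0U' hΘd0
  have hΘeq : (Θ : _ → _) = fun q => Φ (ρ q) := funext hΘ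
  have hΘa : ∀ a, ((0, a), 0) ∈ Θ.source → Θ ((0, a), 0) = l a := by
    intro a ha
    have h1 : ρ ((0, a), 0) = (0, l a) := by simp [hρ]
    have h2 := (hΘU ha).2
    rw [mem_preimage, h1] at h2
    rw [hΘ, h1, hΦ0 _ h2]
  refine ⟨Θ, h0Θ, ?_, ?_, hΘsymm, ?_, ?_, ?_, ?_⟩
  · rw [hΘ, hρ0, hΦ0 _ hD]
  · rw [hΘeq]
    exact hΘs.mono hΘU
  · intro z hz
    rw [← Θ.right_inv hz, hΘ]
    exact hΦO _ (hΘU (Θ.map_target hz)).2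
  · intro q hq
    have hqU := hΘU hq
    rw [hΘ q, ← hΦr _ hqU.2]
    congr 1
    refine LinearMap.ext fun v => ?_
    have h1 : HasFDerivAt (fun x : Fin m → ℝ => ((x, q.1.2), q.2))
        (ContinuousLinearMap.inl ℝ _ _ ∘L ContinuousLinearMap.inl ℝ _ _) q.1.1 := 
      (hasFDerivAt_prodMk_left (𝕜 := ℝ) (q.1.1, q.1.2) q.2).comp q.1.1
        (hasFDerivAt_prodMk_left (𝕜 := ℝ) q.1.1 q.1.2)
    have h2 : HasFDerivAt Θ (fderiv ℝ Θ q) ((q.1.1, q.1.2), q.2) := by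
      rw [hΘeq]
      exact ((hΘs.contDiffAt (hU'o.mem_nhds hqU)).differentiableAt (by simp)).hasFDerivAt
    have h3 := HasFDerivAt.comp (f := fun x : Fin m → ℝ => ((x, q.1.2), q.2)) q.1.1 h2 h1
    have h4 : HasFDerivAt (fun x : Fin m → ℝ => Φ (x, l q.1.2 + R q.2))
        (fderiv ℝ Φ (ρ q) ∘L ContinuousLinearMap.inl ℝ _ _) q.1.1 :=
      HasFDerivAt.comp (f := fun x : Fin m → ℝ => (x, l q.1.2 + R q.2)) q.1.1 (hΦd _ hqU.2)
        (hasFDerivAt_prodMk_left _ _)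
    have h5 : (Θ ∘ fun x : Fin m → ℝ => ((x, q.1.2), q.2)) =
        fun x : Fin m → ℝ => Φ (x, l q.1.2 + R q.2) := funext fun x => hΘ _
    rw [h5] at h3
    exact DFunLike.congr_fun (h3.unique h4) v
  · intro a ha
    rw [hΘa a ha]
    exact hlΛ a (hΘU ha).1
  · have hco : ContinuousOn (fun z => (((0 : Fin m → ℝ), (Ψ z).1 - (Ψ z₀).1), (0 : Fin p → ℝ)))
        Ψ.source := by
      have := Ψ.continuousOn
      fun_prop
    refine ⟨_, hco.isOpen_inter_preimage Ψ.open_source Θ.open_source, ⟨hzΨ, ?_⟩, ?_⟩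
    · rw [mem_preimage, sub_self]
      exact h0Θ
    · rintro z ⟨hzΛ, hzs, hza⟩
      refine ⟨_, hza, ?_⟩
      rw [hΘa _ hza, hl]
      simp only
      rw [hΨz z ⟨hzΛ, hzs⟩, Ψ.left_inv hzs]

/-! ### Tangent extensions -/

/-- In coordinates adapted to the distribution and to `Λ`, every submanifold of dimension `m + k`
which is tangent to the distribution and contains `Λ` is the coordinate slice near the base
point. -/
theorem eventually_mem_iff_of_tangent {N m k p : ℕ} (hN : m + k + p = N)
    {s : Fin m → EuclideanSpace ℝ (Fin N) → EuclideanSpace ℝ (Fin N)}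
    (Θ : OpenPartialHomeomorph (((Fin m → ℝ) × (Fin k → ℝ)) × (Fin p → ℝ))
      (EuclideanSpace ℝ (Fin N))) (h0 : 0 ∈ Θ.source) (hΘ : ContDiffOn ℝ ∞ Θ Θ.source)
    (hΘ' : ContDiffOn ℝ ∞ Θ.symm Θ.target)
    (hrange : ∀ q ∈ Θ.source, (fderiv ℝ Θ q ∘L ContinuousLinearMap.inl ℝ _ _ ∘L
      ContinuousLinearMap.inl ℝ _ _).range = Submodule.span ℝ (range fun i => s i (Θ q)))
    {Γ : Set (EuclideanSpace ℝ (Fin N))} (hΓ : IsEmbeddedSubmanifold (m + k) Γ)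
    (htan : ∀ z ∈ Γ, ∀ i, s i z ∈ tangentSpaceOf Γ z)
    (hsub : ∀ᶠ a : Fin k → ℝ in 𝓝 0, Θ ((0, a), 0) ∈ Γ) :
    ∀ᶠ z in 𝓝 (Θ 0), z ∈ Γ ↔ (Θ.symm z).2 = 0 := by
  obtain ⟨Ψ, hzΨ, hΨ⟩ := hΓ.exists_isSliceChart hN hsub.self_of_nhds
  set κ := Θ.trans Ψ with hκdef
  have h0κ : 0 ∈ κ.source := by
    rw [hκdef, Θ.trans_source]
    exact ⟨h0, hzΨ⟩
  have hsource : ∀ q ∈ κ.source, q ∈ Θ.source ∧ Θ q ∈ Ψ.source := by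
    intro q hq
    rwa [hκdef, Θ.trans_source] at hq
  have hκ : ContDiffOn ℝ ∞ κ κ.source :=
    hΨ.smooth.comp (hΘ.mono fun q hq => (hsource q hq).1) fun q hq => (hsource q hq).2
  have hκ' : ContDiffOn ℝ ∞ κ.symm κ.target := by
    rw [hκdef, Θ.trans_target]
    exact hΘ'.comp (hΨ.smooth_symm.mono fun q hq => hq.1) fun q hq => hq.2
  have hmem : ∀ q ∈ κ.source, Θ q ∈ Γ ↔ (κ q).2 = 0 := fun q hq =>
    hΨ.mem_iff _ (hsource q hq).2
  have h1 := eventually_snd_eq_zero κ hκ hκ' h0κ (by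
    intro q hq hq0 e
    obtain ⟨hqΘ, hqΨ⟩ := hsource q hq
    have hd : HasFDerivAt κ (fderiv ℝ Ψ (Θ q) ∘L fderiv ℝ Θ q) q :=
      ((hΨ.smooth.contDiffAt (Ψ.open_source.mem_nhds hqΨ)).differentiableAt
        (by simp)).hasFDerivAt.comp q
        ((hΘ.contDiffAt (Θ.open_source.mem_nhds hqΘ)).differentiableAt (by simp)).hasFDerivAt
    rw [hd.fderiv]
    refine hΨ.fderiv_snd_eq_zero hqΨ ?_
    have hspan : Submodule.span ℝ (range fun i => s i (Θ q)) ≤ tangentSpaceOf Γ (Θ q) :=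
      Submodule.span_le.2 (range_subset_iff.2 (htan _ ((hmem q hq).2 hq0)))
    refine hspan ?_
    rw [← hrange q hqΘ]
    exact ⟨e, rfl⟩) (by
    have hc : Continuous fun a : Fin k → ℝ =>
      (((0 : Fin m → ℝ), a), (0 : Fin p → ℝ)) := by fun_prop
    filter_upwards [hsub, (κ.open_source.preimage hc).mem_nhds h0κ] with a ha haκ
    exact (hmem _ haκ).1 ha)
  have h2 := eventually_snd_eq_zero_iff κ hκ hκ' h0κ h1
  have h3 : Tendsto Θ.symm (𝓝 (Θ 0)) (𝓝 0) := by
    have := (Θ.continuousAt_symm (Θ.map_source h0)).tendsto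
    rwa [Θ.left_inv h0] at this
  filter_upwards [h3.eventually h2, h3.eventually (κ.open_source.mem_nhds h0κ),
    Θ.open_target.mem_nhds (Θ.map_source h0)] with z hz hzκ hzt
  rw [← hz, ← hmem _ hzκ, Θ.right_inv hzt]

/-- Two submanifolds of dimension `m + k` which are tangent to an involutive distribution of rank
`m` and contain a transverse submanifold `Λ` of dimension `k` near a point of `Λ` agree near that
point. -/
theorem exists_inter_eq_of_tangent {N m k p : ℕ} (hN : m + k + p = N)
    {O : Set (EuclideanSpace ℝ (Fin N))} (hO : IsOpen O)
    {s : Fin m → EuclideanSpace ℝ (Fin N) → EuclideanSpace ℝ (Fin N)}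
    (hframe : IsPartialFrame O s) (hinv : IsInInvolution O s)
    {Λ : Set (EuclideanSpace ℝ (Fin N))} (hΛ : IsEmbeddedSubmanifold k Λ)
    {z₀ : EuclideanSpace ℝ (Fin N)} (hz₀O : z₀ ∈ O) (hz₀ : z₀ ∈ Λ)
    (hdisj : Disjoint (Submodule.span ℝ (range fun i => s i z₀)) (tangentSpaceOf Λ z₀))
    {Γ Γ' : Set (EuclideanSpace ℝ (Fin N))}
    (hΓ : IsEmbeddedSubmanifold (m + k) Γ) (htan : ∀ z ∈ Γ, ∀ i, s i z ∈ tangentSpaceOf Γ z)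
    (hsub : ∀ᶠ z in 𝓝 z₀, z ∈ Λ → z ∈ Γ)
    (hΓ' : IsEmbeddedSubmanifold (m + k) Γ') (htan' : ∀ z ∈ Γ', ∀ i, s i z ∈ tangentSpaceOf Γ' z)
    (hsub' : ∀ᶠ z in 𝓝 z₀, z ∈ Λ → z ∈ Γ') :
    ∃ W, IsOpen W ∧ z₀ ∈ W ∧ Γ ∩ W = Γ' ∩ W := by
  obtain ⟨Θ, h0, rfl, hΘ, hΘ', -, hrange, hΘΛ, -⟩ :=
    exists_adapted_chart hN hO hframe hinv hΛ hz₀O hz₀ hdisj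
  have hc : Continuous fun a : Fin k → ℝ => (((0 : Fin m → ℝ), a), (0 : Fin p → ℝ)) := by fun_prop
  have hcΘ : Tendsto (fun a : Fin k → ℝ => Θ ((0, a), 0)) (𝓝 0) (𝓝 (Θ 0)) :=
    (Θ.continuousAt h0).tendsto.comp (hc.tendsto' _ _ rfl)
  have hcs : ∀ᶠ a : Fin k → ℝ in 𝓝 0, ((0, a), 0) ∈ Θ.source :=
    (Θ.open_source.preimage hc).mem_nhds h0
  have h1 := eventually_mem_iff_of_tangent hN Θ h0 hΘ hΘ' hrange hΓ htan (by
    filter_upwards [hcΘ.eventually hsub, hcs] with a ha has using ha (hΘΛ a has))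
  have h2 := eventually_mem_iff_of_tangent hN Θ h0 hΘ hΘ' hrange hΓ' htan' (by
    filter_upwards [hcΘ.eventually hsub', hcs] with a ha has using ha (hΘΛ a has))
  obtain ⟨W, hW, hWo, hzW⟩ := eventually_nhds_iff.1 (h1.and h2)
  refine ⟨W, hWo, hzW, ext fun z => and_congr_left fun hz => ?_⟩
  rw [(hW z hz).1, (hW z hz).2]

/-- The image of the slice `b = 0` under adapted coordinates is a tangent extension. -/
theorem exists_isTangentExtension {m k p : ℕ}
    {O : Set (EuclideanSpace ℝ (Fin (m + k + p)))} (hO : IsOpen O)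
    {s : Fin m → EuclideanSpace ℝ (Fin (m + k + p)) → EuclideanSpace ℝ (Fin (m + k + p))}
    (hframe : IsPartialFrame O s) (hinv : IsInInvolution O s)
    {Λ : Set (EuclideanSpace ℝ (Fin (m + k + p)))} (hΛ : IsEmbeddedSubmanifold k Λ)
    {z₀ : EuclideanSpace ℝ (Fin (m + k + p))} (hz₀O : z₀ ∈ O) (hz₀ : z₀ ∈ Λ)
    (hdisj : Disjoint (Submodule.span ℝ (range fun i => s i z₀)) (tangentSpaceOf Λ z₀)) :
    ∃ U Γ, IsTangentExtension (m + k) O s Λ z₀ U Γ := by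
  obtain ⟨Θ, h0, hΘ0, hΘ, hΘ', hΘO, hrange, hΘΛ, U, hU, hzU, hUΛ⟩ :=
    exists_adapted_chart rfl hO hframe hinv hΛ hz₀O hz₀ hdisj
  have hz₀t : z₀ ∈ Θ.target := hΘ0 ▸ Θ.map_source h0
  set Γ : Set (EuclideanSpace ℝ (Fin (m + k + p))) :=
    {z | z ∈ U ∩ Θ.target ∧ (Θ.symm z).2 = 0} with hΓ
  have hUo : IsOpen (U ∩ Θ.target) := hU.inter Θ.open_target
  refine ⟨U ∩ Θ.target, Γ, hUo, ⟨hzU, hz₀t⟩, fun z hz => hΘO hz.2, ?_,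
    fun z hz => hΘO hz.1.2, ?_, ?_⟩
  · refine isEmbeddedSubmanifold_of_isSliceChart (A := (Fin m → ℝ) × (Fin k → ℝ))
      (B := Fin p → ℝ) (by simp) (by simp) fun z hz =>
        ⟨Θ.symm.restrOpen U hU, ⟨hz.1.2, hz.1.1⟩, ?_, ?_, ?_⟩
    · exact hΘ'.mono inter_subset_left
    · exact hΘ.mono fun q hq => hq.1
    · exact fun x hx => ⟨fun h => h.2, fun h => ⟨⟨hx.2, hx.1⟩, h⟩⟩
  · refine Subset.antisymm (fun z hz => ⟨hz.1, hz.2, ?_⟩) fun z hz => ⟨hz.1, hz.2.1⟩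
    obtain ⟨a, ha, rfl⟩ := hUΛ z ⟨hz.1, hz.2.1⟩
    rw [Θ.left_inv ha]
  · intro z hz i
    set q := Θ.symm z with hq
    have hqs : q ∈ Θ.source := Θ.map_target hz.1.2
    have hΘq : Θ q = z := Θ.right_inv hz.1.2
    have h1 : s i z ∈ Submodule.span ℝ (range fun i => s i (Θ q)) := by
      rw [hΘq]
      exact Submodule.subset_span ⟨i, rfl⟩
    rw [← hrange q hqs] at h1
    obtain ⟨e, he⟩ := h1
    rw [← he, ← hΘq]
    refine fderiv_mem_tangentSpaceOf (Θ.continuousOn.isOpen_inter_preimage Θ.open_source hU)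
      (hΘ.mono inter_subset_left) ⟨hqs, ?_⟩ fun t ht => ⟨⟨ht.2, Θ.map_source ht.1⟩, ?_⟩
    · rw [mem_preimage, hΘq]
      exact hz.1.1
    · rw [Θ.left_inv ht.1]
      simpa using hz.2

/-- A part `G` of a tangent extension `Γ` which is open in `Γ` and contains the part of `Λ` in a
smaller neighbourhood `V` (and no more of `Λ`) is again a tangent extension. -/
theorem IsTangentExtension.restrict {N m n : ℕ} {O : Set (EuclideanSpace ℝ (Fin N))}
    {s : Fin m → EuclideanSpace ℝ (Fin N) → EuclideanSpace ℝ (Fin N)}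
    {Λ : Set (EuclideanSpace ℝ (Fin N))} {z₀ : EuclideanSpace ℝ (Fin N)}
    {U Γ V G : Set (EuclideanSpace ℝ (Fin N))}
    (h : IsTangentExtension n O s Λ z₀ U Γ) (hV : IsOpen V) (hzV : z₀ ∈ V) (hVU : V ⊆ U)
    (hGΓ : G ⊆ Γ) (hΛG : Λ ∩ V = Λ ∩ G)
    (hloc : ∀ z ∈ G, ∃ W, IsOpen W ∧ z ∈ W ∧ G ∩ W = Γ ∩ W) :
    IsTangentExtension n O s Λ z₀ V G where
  isOpen := hV
  mem := hzV
  subset := hVU.trans h.subset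
  submanifold := isEmbeddedSubmanifold_of_local fun z hz => by
    obtain ⟨W, hW, hzW, hGW⟩ := hloc z hz
    exact ⟨W, Γ, hW, hzW, h.submanifold, hGW⟩
  subset_domain := hGΓ.trans h.subset_domain
  inter_eq := hΛG
  tangent := fun z hz i => by
    obtain ⟨W, hW, hzW, hGW⟩ := hloc z hz
    exact tangentSpaceOf_mono_local hW hzW (hGW.superset.trans inter_subset_left)
      (h.tangent z (hGΓ hz) i)

theorem tangentSpaceOf_singleton {N : ℕ} (z : EuclideanSpace ℝ (Fin N)) :
    tangentSpaceOf {z} z = ⊥ := by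
  refine Submodule.span_eq_bot.2 ?_
  rintro v ⟨γ, ε, hε, -, hγ, -, hv⟩
  refine hv.unique ((hasDerivAt_const (0:ℝ) z).congr_of_eventuallyEq ?_)
  filter_upwards [Ioo_mem_nhds (neg_lt_zero.2 hε) hε] with t ht using hγ t ht

theorem theorem3p1 (n m p : ℕ) (hm : 1 ≤ m) (hmn : m ≤ n) (hp : 1 ≤ p)
    (O : Set (EuclideanSpace ℝ (Fin (n + p)))) (hO : IsOpen O)
    (s : Fin m → EuclideanSpace ℝ (Fin (n + p)) → EuclideanSpace ℝ (Fin (n + p)))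
    (hframe : IsPartialFrame O s) (hinv : IsInInvolution O s)
    (Λ : Set (EuclideanSpace ℝ (Fin (n + p)))) (hΛO : Λ ⊆ O)
    (hΛ : IsEmbeddedSubmanifold (n - m) Λ)
    (hcompl : ∀ z ∈ Λ,
      Disjoint (Submodule.span ℝ (Set.range fun i => s i z)) (tangentSpaceOf Λ z))
    (zbar : EuclideanSpace ℝ (Fin (n + p))) (hzbar : zbar ∈ Λ) :
    (∃ U Γ : Set (EuclideanSpace ℝ (Fin (n + p))), IsTangentExtension n O s Λ zbar U Γ) ∧
    (∀ U Γ U' Γ' : Set (EuclideanSpace ℝ (Fin (n + p))),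
      IsTangentExtension n O s Λ zbar U Γ → IsTangentExtension n O s Λ zbar U' Γ' →
        (∃ V : Set (EuclideanSpace ℝ (Fin (n + p))),
          V ⊆ U ∩ U' ∧ Λ ∩ V = Λ ∩ (U ∩ U') ∧ Γ ∩ V = Γ' ∩ V ∧
          IsTangentExtension n O s Λ zbar V (Γ ∩ Γ' ∩ V)) ∧
        (m = n → IsTangentExtension n O s Λ zbar (U ∩ U') (Γ ∩ Γ'))) := by
  obtain ⟨k, rfl⟩ := Nat.exists_eq_add_of_le hmn
  rw [Nat.add_sub_cancel_left] at hΛ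
  refine ⟨exists_isTangentExtension hO hframe hinv hΛ (hΛO hzbar) hzbar (hcompl zbar hzbar),
    fun U Γ U' Γ' h h' => ⟨?_, fun hmk => ?_⟩⟩
  · have hsub : ∀ {U Γ}, IsTangentExtension (m + k) O s Λ zbar U Γ → ∀ z ∈ U,
        ∀ᶠ x in 𝓝 z, x ∈ Λ → x ∈ Γ := by
      intro U Γ h z hz
      filter_upwards [h.isOpen.mem_nhds hz] with x hx hxΛ
      exact (h.inter_eq.subset ⟨hxΛ, hx⟩).2
    have hW : ∀ z ∈ Λ ∩ (U ∩ U'), ∃ W, IsOpen W ∧ z ∈ W ∧ Γ ∩ W = Γ' ∩ W := fun z hz =>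
      exists_inter_eq_of_tangent rfl hO hframe hinv hΛ (hΛO hz.1) hz.1 (hcompl z hz.1)
        h.submanifold h.tangent (hsub h z hz.2.1) h'.submanifold h'.tangent (hsub h' z hz.2.2)
    -- the largest open subset of `U ∩ U'` in which `Γ` and `Γ'` agree
    set V : Set (EuclideanSpace ℝ (Fin (m + k + p))) :=
      ⋃₀ {W | IsOpen W ∧ W ⊆ U ∩ U' ∧ Γ ∩ W = Γ' ∩ W} with hV
    have hVo : IsOpen V := isOpen_sUnion fun W hW => hW.1
    have hVU : V ⊆ U ∩ U' := sUnion_subset fun W hW => hW.2.1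
    have hΛV : Λ ∩ V = Λ ∩ (U ∩ U') := by
      refine Subset.antisymm (inter_subset_inter_right _ hVU) fun z hz => ⟨hz.1, ?_⟩
      obtain ⟨W, hWo, hzW, hWeq⟩ := hW z hz
      refine ⟨W ∩ (U ∩ U'), ⟨hWo.inter (h.isOpen.inter h'.isOpen), inter_subset_right, ?_⟩,
        hzW, hz.2⟩
      rw [← inter_assoc, hWeq, inter_assoc]
    have hΓV : Γ ∩ V = Γ' ∩ V := by
      rw [hV, sUnion_eq_biUnion, inter_iUnion₂, inter_iUnion₂]
      exact iUnion₂_congr fun W hW => hW.2.2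
    have hzV : zbar ∈ V := (hΛV.superset ⟨hzbar, h.mem, h'.mem⟩).2
    refine ⟨V, hVU, hΛV, hΓV, ?_⟩
    have hG : Γ ∩ Γ' ∩ V = Γ ∩ V := by
      rw [inter_assoc, ← hΓV, ← inter_assoc, inter_self]
    rw [hG]
    refine h.restrict hVo hzV (hVU.trans inter_subset_left) inter_subset_left ?_ fun z hz =>
      ⟨V, hVo, hz.2, by rw [inter_assoc, inter_self]⟩
    rw [← inter_assoc, ← h.inter_eq, inter_assoc,
      inter_eq_self_of_subset_right (hVU.trans inter_subset_left)]
  · obtain rfl : k = 0 := by omega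
    -- `Γ` and `Γ'` are integral manifolds, hence agree near each common point `z`: replace `Λ`
    -- by `{z}`
    have hW : ∀ z ∈ Γ ∩ Γ', ∃ W, IsOpen W ∧ z ∈ W ∧ Γ ∩ W = Γ' ∩ W := fun z hz =>
      exists_inter_eq_of_tangent rfl hO hframe hinv (isEmbeddedSubmanifold_zero_singleton z)
        (h.subset_domain hz.1) (mem_singleton z)
        (by rw [tangentSpaceOf_singleton]; exact disjoint_bot_right)
        h.submanifold h.tangent (Eventually.of_forall fun x hx => hx ▸ hz.1)
        h'.submanifold h'.tangent (Eventually.of_forall fun x hx => hx ▸ hz.2)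
    refine h.restrict (h.isOpen.inter h'.isOpen) ⟨h.mem, h'.mem⟩ inter_subset_left inter_subset_left
      ?_ fun z hz => ?_
    · rw [inter_inter_distrib_left, h.inter_eq, h'.inter_eq, ← inter_inter_distrib_left]
    · obtain ⟨W, hWo, hzW, hWeq⟩ := hW z hz
      refine ⟨W, hWo, hzW, ?_⟩
      rw [inter_inter_distrib_right, ← hWeq, inter_self]
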